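/- **Setting.** A non-commutative probability space $(\mathcal A,\varphi)$ is a unital complex algebra with a linear functional $\varphi$, $\varphi(1)=1$. Let $I,J$ be disjoint sets. A two-faced family $z=((z_i)_{i\in I},(z_j)_{j\in J})$ in $(\mathcal A,\varphi)$ consists of left variables $z_i\in\mathcal A$ ($i\in I$) and right variables $z_j\in\mathcal A$ ($j\in J$); its distribution is the functional $\mu_z:\mathbb C\langle Z_k\mid k\in I\sqcup J\rangle\to\mathbb C$, $\mu_z(P)=\varphi(P(z))$. For vector spaces $\mathcal X_k=\mathbb C\xi_k\oplus\mathring{\mathcal X}_k$ with specified state vectors $\xi_k\neq0$, the free product is $$\mathcal X=\mathbb C\xi\oplus\bigoplus_{n\ge1}\ \bigoplus_{k_1\ne k_2\ne\dots\ne k_n}\mathring{\mathcal X}_{k_1}\otimes\dots\otimes\mathring{\mathcal X}_{k_n}.$$ A linear operator $T$ on $\mathcal X_k$ acts on $\mathcal X$ by $\lambda_k(T)$ (by $\rho_k(T)$) through $T$ on the first (last) tensor leg in $\mathcal X_k$, this leg being $\xi_k$ if the tensor does not begin (end) in $\mathring{\mathcal X}_k$, and $\xi_k$ being identified with the empty tensor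 $\xi$. Operators on $\mathcal X$ have the expectation given by the coefficient of $\xi$ in $T\xi$. Two-faced families $z^{(k)}$ are bi-free if their joint distribution is that of $\lambda_k(T^{(k)}_i)$ $(i\in I)$, $\rho_k(T^{(k)}_j)$ $(j\in J)$ for some such spaces $\mathcal X_k$ and some operators $T^{(k)}_a$ on $\mathcal X_k$. For a word $s=a_1\dots a_n$ $(n\ge1)$ in $I\sqcup J$, the bi-free cumulant $R_{s}$ is the unique polynomial in variables $X_t$, $t$ a non-empty subword of $s$, of the form $X_s$ plus a polynomial in the $X_t$ with $t\neq s$, homogeneous of degree $n$ when $X_t$ has degree $|t|$, such that $R_s(z'+z'')=R_s(z')+R_s(z'')$ for every bi-free pair $z',z''$; here $R_s(z)=R_s(\mu_z)$ is the value at $X_{b_1\dots b_m}=\varphi(z_{b_1}\cdots z_{b_m})$. A unital functional $\gamma$ on $\mathbb C\langle Z_k\mid k\in I\sqcup J\rangle$ is a bi-free central limit distribution if $R_{a_1\dots a_n}(\gamma)=0$ whenever $n=1$ or $n\ge3$. For a complex Hilbert space $\mathcal H$ with inner product linear in the first variable, let $\mathcal T(\mathcal H)=\mathbb C1\oplus\bigoplus_{n\ge1}\mathcal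 H^{\otimes n}$ be the full Fock space, $l(h)\zeta=h\otimes\zeta$, $r(h)\zeta=\zeta\otimes h$, $l^*(h)=l(h)^*$, $r^*(h)=r(h)^*$; bounded operators on $\mathcal T(\mathcal H)$ carry the functional $T\mapsto\langle T1,1\rangle$. **Theorem 7.4.** 1. For every complex matrix $C=(C_{kl})_{k,l\in I\sqcup J}$ there is exactly one bi-free central limit distribution $\gamma_C$ with $\gamma_C(Z_kZ_l)=C_{kl}$ for all $k,l\in I\sqcup J$. 2. If $h,h^*:I\sqcup J\to\mathcal H$ are maps into a complex Hilbert space, then the two-faced family $z_i=l(h(i))+l^*(h^*(i))$ $(i\in I)$, $z_j=r(h(j))+r^*(h^*(j))$ $(j\in J)$ has the bi-free central limit distribution $\gamma_C$ with $C_{kl}=\langle h(l),h^*(k)\rangle$. 3. If $I$ and $J$ are finite, every bi-free central limit distribution is the distribution of such a family. -/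

import Mathlib

open scoped TensorProduct

universe u v w x

noncomputable section

namespace BiFree

/-! ### Distributions

A non-commutative probability space is a unital complex algebra `A` with a linear functional
`φ : A → ℂ` such that `φ 1 = 1`.  A two-faced family in `A` with left index set `I` and right index
set `J` is a map `z : I ⊕ J → A`; the `z (Sum.inl i)` are the left variables and the `z (Sum.inr j)`
the right variables. -/

/-- The joint distribution of a family `z` of elements of `(A, φ)`: the functional
`P ↦ φ (P(z))` on the algebra of non-commutative polynomials. -/
def distribution {S : Type u} {A : Type v} [Ring A] [Algebra ℂ A] (φ : A →ₗ[ℂ] ℂ) (z : S → A) :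
    FreeAlgebra ℂ S →ₗ[ℂ] ℂ :=
  φ ∘ₗ (FreeAlgebra.lift ℂ z).toLinearMap

/-- The moment of `γ` at the word `s = s₁ ⋯ sₙ`, that is `γ (Z_{s₁} ⋯ Z_{sₙ})`. -/
def moment {S : Type u} (γ : FreeAlgebra ℂ S →ₗ[ℂ] ℂ) (s : List S) : ℂ :=
  γ (s.map (FreeAlgebra.ι ℂ)).prod

/-! ### Free products of vector spaces with specified state vector -/

/-- A complex vector space `X` with a specified state vector `ξ` and the functional `ψ` with
`ψ ξ = 1`; the specified complement of `ℂ ξ` is `ker ψ`. -/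
structure StateSpace where
  carrier : Type u
  [grp : AddCommGroup carrier]
  [mod : Module ℂ carrier]
  ξ : carrier
  ψ : carrier →ₗ[ℂ] ℂ
  ψ_ξ : ψ ξ = 1

attribute [instance] StateSpace.grp StateSpace.mod

namespace StateSpace

/-- The specified subspace of codimension one. -/
abbrev ker₀ (X : StateSpace.{u}) : Submodule ℂ X.carrier := LinearMap.ker X.ψ

/-- The projection `x ↦ x - ψ(x) ξ` onto the specified subspace, along `ξ`. -/
def proj₀ (X : StateSpace.{u}) : X.carrier →ₗ[ℂ] X.ker₀ :=
  (LinearMap.id - X.ψ.smulRight X.ξ).codRestrict X.ker₀ (fun x => by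
    simp [X.ψ_ξ])

theorem coe_proj₀ (X : StateSpace.{u}) (x : X.carrier) :
    (X.proj₀ x : X.carrier) = x - X.ψ x • X.ξ := rfl

end StateSpace

section FreeProduct

set_option linter.unusedSectionVars false

variable {K : Type x} [DecidableEq K] (X : K → StateSpace.{u})

/-- The direct sum of the specified subspaces of the `X k`. -/
abbrev Letters : Type (max x u) := DirectSum K (fun k => (X k).ker₀)

/-- The tensor algebra `⨁_{n ≥ 0} ⨁_{k₁, …, kₙ} X°_{k₁} ⊗ ⋯ ⊗ X°_{kₙ}` over the direct sum of the
specified subspaces `X°_k`. Its product is concatenation of tensors and its unit is the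
empty tensor. -/
abbrev Tensors : Type (max x u) := TensorAlgebra ℂ (Letters X)

/-- The vector `x ∈ X°_k`, as a tensor of length one. -/
def letter (k : K) (x : (X k).ker₀) : Tensors X :=
  TensorAlgebra.ι ℂ (DirectSum.lof ℂ K (fun k => (X k).ker₀) k x)

/-- The inclusion of `X_k = ℂ ξ_k ⊕ X°_k`, where `ξ_k` becomes the empty tensor `1`. -/
def incl (k : K) : (X k).carrier →ₗ[ℂ] Tensors X :=
  (X k).ψ.smulRight (1 : Tensors X) +
    TensorAlgebra.ι ℂ ∘ₗ DirectSum.lof ℂ K (fun k => (X k).ker₀) k ∘ₗ (X k).proj₀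

/-- The elementary tensor `x₁ ⊗ ⋯ ⊗ xₙ` of a list of vectors from the `X°_k`. -/
def word (l : List (Σ k, (X k).ker₀)) : Tensors X :=
  (l.map fun p => letter X p.1 p.2).prod

/-- Neighbouring vectors of the list come from different spaces. -/
def Alternating (l : List (Σ k, (X k).ker₀)) : Prop :=
  (l.map Sigma.fst).IsChain (· ≠ ·)

/-- The free product of vector spaces
`ℂ ξ ⊕ ⨁_{n ≥ 1} ⨁_{k₁ ≠ k₂ ≠ ⋯ ≠ kₙ} X°_{k₁} ⊗ ⋯ ⊗ X°_{kₙ}`, where `ξ` is the empty tensor. -/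
def FreeProduct : Submodule ℂ (Tensors X) :=
  Submodule.span ℂ {t | ∃ l, Alternating X l ∧ t = word X l}

/-- Auxiliary to `recLeft`: a tensor `t` of length one acts on pairs by
`(s, s') ↦ (t ⊗ s, G t s)`. -/
def recLeftHom (G : Letters X →ₗ[ℂ] Tensors X →ₗ[ℂ] Tensors X) :
    Tensors X →ₐ[ℂ] Module.End ℂ (Tensors X × Tensors X) :=
  TensorAlgebra.lift ℂ
    { toFun := fun v =>
        (LinearMap.mulLeft ℂ (TensorAlgebra.ι ℂ v) ∘ₗ LinearMap.fst ℂ _ _).prod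
          (G v ∘ₗ LinearMap.fst ℂ _ _)
      map_add' := fun a b => by
        refine LinearMap.ext fun p => ?_
        simp [add_mul]
      map_smul' := fun a b => by
        refine LinearMap.ext fun p => ?_
        simp }

/-- The linear map on tensors that sends `1` to `m` and `v ⊗ t` to `G v t`, for `v` of length
one (see `recLeft_one` and `recLeft_mul`). -/
def recLeft (m : Tensors X) (G : Letters X →ₗ[ℂ] Tensors X →ₗ[ℂ] Tensors X) :
    Tensors X →ₗ[ℂ] Tensors X :=
  LinearMap.snd ℂ (Tensors X) (Tensors X) ∘ₗ
    LinearMap.applyₗ ((1 : Tensors X), m) ∘ₗ (recLeftHom X G).toLinearMap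

/-- Auxiliary to `recRight`, the mirror image of `recLeftHom`. -/
def recRightHom (G : Letters X →ₗ[ℂ] Tensors X →ₗ[ℂ] Tensors X) :
    Tensors X →ₐ[ℂ] (Module.End ℂ (Tensors X × Tensors X))ᵐᵒᵖ :=
  TensorAlgebra.lift ℂ
    { toFun := fun v => MulOpposite.op
        ((LinearMap.mulRight ℂ (TensorAlgebra.ι ℂ v) ∘ₗ LinearMap.fst ℂ _ _).prod
          (G v ∘ₗ LinearMap.fst ℂ _ _))
      map_add' := fun a b => by
        refine MulOpposite.unop_injective (LinearMap.ext fun p => ?_)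
        simp [mul_add]
      map_smul' := fun a b => by
        refine MulOpposite.unop_injective (LinearMap.ext fun p => ?_)
        simp }

/-- The linear map on tensors that sends `1` to `m` and `t ⊗ v` to `G v t`, for `v` of length
one (see `recRight_one` and `recRight_mul`). -/
def recRight (m : Tensors X) (G : Letters X →ₗ[ℂ] Tensors X →ₗ[ℂ] Tensors X) :
    Tensors X →ₗ[ℂ] Tensors X :=
  LinearMap.snd ℂ (Tensors X) (Tensors X) ∘ₗ
    LinearMap.applyₗ ((1 : Tensors X), m) ∘ₗ
    (MulOpposite.opLinearEquiv ℂ).symm.toLinearMap ∘ₗ (recRightHom X G).toLinearMap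

theorem recLeftHom_fst (G : Letters X →ₗ[ℂ] Tensors X →ₗ[ℂ] Tensors X) (t : Tensors X)
    (p : Tensors X × Tensors X) : (recLeftHom X G t p).1 = t * p.1 := by
  induction t using TensorAlgebra.induction generalizing p with
  | algebraMap r => simp [Algebra.smul_def]
  | ι v => simp [recLeftHom]
  | mul a b ha hb => simp [ha, hb, mul_assoc]
  | add a b ha hb => simp [ha, hb, add_mul]

theorem recRightHom_fst (G : Letters X →ₗ[ℂ] Tensors X →ₗ[ℂ] Tensors X) (t : Tensors X)
    (p : Tensors X × Tensors X) : ((recRightHom X G t).unop p).1 = p.1 * t := by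
  induction t using TensorAlgebra.induction generalizing p with
  | algebraMap r => simp [Algebra.smul_def, Algebra.commutes]
  | ι v => simp [recRightHom]
  | mul a b ha hb => simp [ha, hb, mul_assoc]
  | add a b ha hb => simp [ha, hb, mul_add]

theorem recLeft_one (m : Tensors X) (G : Letters X →ₗ[ℂ] Tensors X →ₗ[ℂ] Tensors X) :
    recLeft X m G 1 = m := by
  simp [recLeft]

theorem recLeft_mul (m : Tensors X) (G : Letters X →ₗ[ℂ] Tensors X →ₗ[ℂ] Tensors X)
    (v : Letters X) (t : Tensors X) :
    recLeft X m G (TensorAlgebra.ι ℂ v * t) = G v t := by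
  have h := recLeftHom_fst X G t (1, m)
  simp only [mul_one] at h
  have h2 : recLeftHom X G (TensorAlgebra.ι ℂ v) =
      (LinearMap.mulLeft ℂ (TensorAlgebra.ι ℂ v) ∘ₗ LinearMap.fst ℂ _ _).prod
          (G v ∘ₗ LinearMap.fst ℂ _ _) := by
    simp [recLeftHom]
  simp [recLeft, h2, h]

theorem recRight_one (m : Tensors X) (G : Letters X →ₗ[ℂ] Tensors X →ₗ[ℂ] Tensors X) :
    recRight X m G 1 = m := by
  simp [recRight]

theorem recRight_mul (m : Tensors X) (G : Letters X →ₗ[ℂ] Tensors X →ₗ[ℂ] Tensors X)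
    (v : Letters X) (t : Tensors X) :
    recRight X m G (t * TensorAlgebra.ι ℂ v) = G v t := by
  have h := recRightHom_fst X G t (1, m)
  simp only [one_mul] at h
  have h2 : recRightHom X G (TensorAlgebra.ι ℂ v) = MulOpposite.op
      ((LinearMap.mulRight ℂ (TensorAlgebra.ι ℂ v) ∘ₗ LinearMap.fst ℂ _ _).prod
          (G v ∘ₗ LinearMap.fst ℂ _ _)) := by
    simp [recRightHom]
  simp [recRight, h2, h]

/-- The part of `v ∈ ⨁_j X°_j` outside `X°_k`. -/
def others (k : K) : Letters X →ₗ[ℂ] Letters X :=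
  LinearMap.id - DirectSum.lof ℂ K (fun k => (X k).ker₀) k ∘ₗ
    DirectSum.component ℂ K (fun k => (X k).ker₀) k

/-- `λ_k(T)` on tensors, `T` acting on the first leg in `X_k` (which is `ξ_k`, if the tensor does
not begin in `X°_k`):
`1 ↦ T ξ_k`, `x ⊗ t ↦ (T x) ⊗ t` for `x ∈ X°_k`, and
`x ⊗ t ↦ (T ξ_k) ⊗ x ⊗ t` for `x ∈ X°_j`, `j ≠ k`; here `X_k = ℂ 1 ⊕ X°_k`. -/
def leftTensor (k : K) (T : Module.End ℂ (X k).carrier) : Tensors X →ₗ[ℂ] Tensors X :=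
  recLeft X (incl X k (T (X k).ξ))
    (LinearMap.mul ℂ (Tensors X) ∘ₗ incl X k ∘ₗ T ∘ₗ (X k).ker₀.subtype ∘ₗ
        DirectSum.component ℂ K (fun k => (X k).ker₀) k +
      LinearMap.mul ℂ (Tensors X) ∘ₗ LinearMap.mulLeft ℂ (incl X k (T (X k).ξ)) ∘ₗ
        TensorAlgebra.ι ℂ ∘ₗ others X k)

/-- `ρ_k(T)` on tensors, the mirror image of `leftTensor`:
`1 ↦ T ξ_k`, `t ⊗ x ↦ t ⊗ (T x)` for `x ∈ X°_k`, and
`t ⊗ x ↦ t ⊗ x ⊗ (T ξ_k)` for `x ∈ X°_j`, `j ≠ k`. -/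
def rightTensor (k : K) (T : Module.End ℂ (X k).carrier) : Tensors X →ₗ[ℂ] Tensors X :=
  recRight X (incl X k (T (X k).ξ))
    ((LinearMap.mul ℂ (Tensors X)).flip ∘ₗ incl X k ∘ₗ T ∘ₗ (X k).ker₀.subtype ∘ₗ
        DirectSum.component ℂ K (fun k => (X k).ker₀) k +
      (LinearMap.mul ℂ (Tensors X)).flip ∘ₗ LinearMap.mulRight ℂ (incl X k (T (X k).ξ)) ∘ₗ
        TensorAlgebra.ι ℂ ∘ₗ others X k)

theorem others_same (k : K) (y : (X k).ker₀) :
    others X k (DirectSum.lof ℂ K (fun k => (X k).ker₀) k y) = 0 := by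
  simp [others, DirectSum.component.lof_self]

theorem others_ne {j k : K} (h : j ≠ k) (y : (X j).ker₀) :
    others X k (DirectSum.lof ℂ K (fun k => (X k).ker₀) j y) =
      DirectSum.lof ℂ K (fun k => (X k).ker₀) j y := by
  simp [others, DirectSum.component.of, h]

theorem leftTensor_one (k : K) (T : Module.End ℂ (X k).carrier) :
    leftTensor X k T 1 = incl X k (T (X k).ξ) := recLeft_one ..

theorem leftTensor_same (k : K) (T : Module.End ℂ (X k).carrier) (y : (X k).ker₀)
    (t : Tensors X) : leftTensor X k T (letter X k y * t) = incl X k (T y) * t := by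
  simp [leftTensor, letter, recLeft_mul, others_same, DirectSum.component.lof_self]

theorem leftTensor_ne {j k : K} (h : j ≠ k) (T : Module.End ℂ (X k).carrier) (y : (X j).ker₀)
    (t : Tensors X) :
    leftTensor X k T (letter X j y * t) = incl X k (T (X k).ξ) * (letter X j y * t) := by
  simp [leftTensor, letter, recLeft_mul, others_ne, h, DirectSum.component.of, mul_assoc]

theorem rightTensor_one (k : K) (T : Module.End ℂ (X k).carrier) :
    rightTensor X k T 1 = incl X k (T (X k).ξ) := recRight_one ..

theorem rightTensor_same (k : K) (T : Module.End ℂ (X k).carrier) (y : (X k).ker₀)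
    (t : Tensors X) : rightTensor X k T (t * letter X k y) = t * incl X k (T y) := by
  simp [rightTensor, letter, recRight_mul, others_same, DirectSum.component.lof_self]

theorem rightTensor_ne {j k : K} (h : j ≠ k) (T : Module.End ℂ (X k).carrier) (y : (X j).ker₀)
    (t : Tensors X) :
    rightTensor X k T (t * letter X j y) = (t * letter X j y) * incl X k (T (X k).ξ) := by
  simp [rightTensor, letter, recRight_mul, others_ne, h, DirectSum.component.of, mul_assoc]

theorem incl_apply (k : K) (y : (X k).carrier) :
    incl X k y = (X k).ψ y • (1 : Tensors X) + letter X k ((X k).proj₀ y) := rfl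

theorem word_mem {l : List (Σ k, (X k).ker₀)} (h : Alternating X l) : word X l ∈ FreeProduct X :=
  Submodule.subset_span ⟨l, h, rfl⟩

theorem incl_mul_word_mem (k : K) (y : (X k).carrier) {l : List (Σ k, (X k).ker₀)}
    (h : Alternating X l) (hk : ∀ j ∈ (l.map Sigma.fst).head?, k ≠ j) :
    incl X k y * word X l ∈ FreeProduct X := by
  rw [incl_apply, add_mul, smul_mul_assoc, one_mul]
  refine add_mem (Submodule.smul_mem _ _ (word_mem X h)) ?_
  have : letter X k ((X k).proj₀ y) * word X l = word X (⟨k, (X k).proj₀ y⟩ :: l) := by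
    simp [word]
  rw [this]
  refine word_mem X ?_
  unfold Alternating at h ⊢
  rw [List.map_cons, List.isChain_cons]
  exact ⟨hk, h⟩

theorem word_mul_incl_mem (k : K) (y : (X k).carrier) {l : List (Σ k, (X k).ker₀)}
    (h : Alternating X l) (hk : ∀ j ∈ (l.map Sigma.fst).getLast?, j ≠ k) :
    word X l * incl X k y ∈ FreeProduct X := by
  rw [incl_apply, mul_add, mul_smul_comm, mul_one]
  refine add_mem (Submodule.smul_mem _ _ (word_mem X h)) ?_
  have : word X l * letter X k ((X k).proj₀ y) = word X (l ++ [⟨k, (X k).proj₀ y⟩]) := by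
    simp [word]
  rw [this]
  refine word_mem X ?_
  unfold Alternating at h ⊢
  rw [List.map_append, List.isChain_append]
  refine ⟨h, by simp, fun a ha b hb => ?_⟩
  simp at hb
  subst hb
  exact hk a ha

theorem leftTensor_mem (k : K) (T : Module.End ℂ (X k).carrier) {t : Tensors X}
    (ht : t ∈ FreeProduct X) : leftTensor X k T t ∈ FreeProduct X := by
  induction ht using Submodule.span_induction with
  | mem t ht =>
    obtain ⟨l, hl, rfl⟩ := ht
    cases l with
    | nil =>
      have h := incl_mul_word_mem X k (T (X k).ξ) hl (by simp)
      simpa [word, leftTensor_one] using h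
    | cons p l =>
      obtain ⟨j, y⟩ := p
      have hw : word X (⟨j, y⟩ :: l) = letter X j y * word X l := by simp [word]
      by_cases hj : j = k
      · subst hj
        rw [hw, leftTensor_same]
        unfold Alternating at hl
        rw [List.map_cons, List.isChain_cons] at hl
        exact incl_mul_word_mem X j (T y) hl.2 hl.1
      · rw [hw, leftTensor_ne X hj, ← hw]
        exact incl_mul_word_mem X k _ hl (by simpa using fun h => hj h.symm)
  | zero => simp
  | add a b _ _ ha hb => rw [map_add]; exact add_mem ha hb
  | smul c a _ ha => rw [map_smul]; exact Submodule.smul_mem _ _ ha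

theorem rightTensor_mem (k : K) (T : Module.End ℂ (X k).carrier) {t : Tensors X}
    (ht : t ∈ FreeProduct X) : rightTensor X k T t ∈ FreeProduct X := by
  induction ht using Submodule.span_induction with
  | mem t ht =>
    obtain ⟨l, hl, rfl⟩ := ht
    rcases List.eq_nil_or_concat' l with rfl | ⟨l, ⟨j, y⟩, rfl⟩
    · have h := word_mul_incl_mem X k (T (X k).ξ) hl (by simp)
      simpa [word, rightTensor_one] using h
    · have hw : word X (l ++ [⟨j, y⟩]) = word X l * letter X j y := by simp [word]
      by_cases hj : j = k
      · subst hj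
        rw [hw, rightTensor_same]
        unfold Alternating at hl
        rw [List.map_append, List.isChain_append] at hl
        exact word_mul_incl_mem X j (T y) hl.1 fun a ha => hl.2.2 a ha j (by simp)
      · rw [hw, rightTensor_ne X hj, ← hw]
        exact word_mul_incl_mem X k _ hl (by simpa using hj)
  | zero => simp
  | add a b _ _ ha hb => rw [map_add]; exact add_mem ha hb
  | smul c a _ ha => rw [map_smul]; exact Submodule.smul_mem _ _ ha

/-- The left operator `λ_k(T)` on the free product. -/
def leftOp (k : K) (T : Module.End ℂ (X k).carrier) : Module.End ℂ (FreeProduct X) :=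
  (leftTensor X k T).restrict fun _ ht => leftTensor_mem X k T ht

/-- The right operator `ρ_k(T)` on the free product. -/
def rightOp (k : K) (T : Module.End ℂ (X k).carrier) : Module.End ℂ (FreeProduct X) :=
  (rightTensor X k T).restrict fun _ ht => rightTensor_mem X k T ht

/-- The specified vector `ξ` of the free product. -/
def vacuum : FreeProduct X :=
  ⟨1, by simpa [word] using word_mem X (l := []) (by simp [Alternating])⟩

/-- The functional `T ↦ ψ(T ξ)` on the operators on the free product, where `ψ` is the coefficient
of the empty tensor. -/
def vacuumState : Module.End ℂ (FreeProduct X) →ₗ[ℂ] ℂ :=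
  (TensorAlgebra.algebraMapInv (R := ℂ) (M := Letters X)).toLinearMap ∘ₗ
    (FreeProduct X).subtype ∘ₗ LinearMap.applyₗ (vacuum X)

end FreeProduct

/-! ### Bi-freeness -/

/-- A family `(z k)_{k ∈ K}` of two-faced families in `(A, φ)` is bi-free if its joint distribution
is the joint distribution of the operators `λ_k(T k i)`, `i ∈ I`, and `ρ_k(T k j)`, `j ∈ J`, on the
free product of some spaces `X k` with specified state vectors, for some operators `T k a` on
`X k`.  (No generality is lost by taking the `X k` in the universe of the free algebra on
`I ⊕ J`, with its left multiplication operators and the distribution of `z k`.) -/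
def IsBifree {K : Type x} [DecidableEq K] {I : Type u} {J : Type v} {A : Type w} [Ring A]
    [Algebra ℂ A] (φ : A →ₗ[ℂ] ℂ) (z : K → I ⊕ J → A) : Prop :=
  ∃ (X : K → StateSpace.{max u v}) (T : ∀ k, I ⊕ J → Module.End ℂ (X k).carrier),
    distribution φ (fun p : K × (I ⊕ J) => z p.1 p.2) =
      distribution (vacuumState X) (fun p : K × (I ⊕ J) =>
        Sum.elim (fun i => leftOp X p.1 (T p.1 (Sum.inl i)))
          (fun j => rightOp X p.1 (T p.1 (Sum.inr j))) p.2)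

/-! ### Bi-free cumulants and central limit distributions -/

/-- `P` is the bi-free cumulant polynomial `R_s` of the word `s`: it is a polynomial in the
variables `X_t`, `t` a non-empty subword of `s`, it is the sum of `X_s` and a polynomial in the
`X_t` with `t` a proper subword, it is homogeneous of degree `|s|` when `X_t` has degree `|t|`, and
it has the cumulant property: at the moments of bi-free `z'` and `z''` its values add up to its
value at the moments of `z' + z''`.  For a non-empty word these conditions determine `P`, and
testing them on algebras `A` in the universe of the free algebra on `I ⊕ J` is enough, as only the
joint distribution of `z'` and `z''` matters. -/
def IsCumulantPolynomial {I : Type u} {J : Type v} (s : List (I ⊕ J))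
    (P : MvPolynomial (List (I ⊕ J)) ℂ) : Prop :=
  (∃ Q : MvPolynomial (List (I ⊕ J)) ℂ, P = MvPolynomial.X s + Q ∧
    ∀ t ∈ Q.vars, t ≠ [] ∧ t.Sublist s ∧ t ≠ s) ∧
  MvPolynomial.IsWeightedHomogeneous (fun t : List (I ⊕ J) => t.length) P s.length ∧
  ∀ (A : Type max u v) [Ring A] [Algebra ℂ A] (φ : A →ₗ[ℂ] ℂ) (z' z'' : I ⊕ J → A),
    φ 1 = 1 → IsBifree φ ![z', z''] →
      MvPolynomial.eval (moment (distribution φ z')) P +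
        MvPolynomial.eval (moment (distribution φ z'')) P =
      MvPolynomial.eval (moment (distribution φ (z' + z''))) P

/-- The bi-free cumulant `R_s(γ)`, the value of the cumulant polynomial `R_s` at the moments of `γ`,
exists and equals `c`. -/
def HasCumulant {I : Type u} {J : Type v} (γ : FreeAlgebra ℂ (I ⊕ J) →ₗ[ℂ] ℂ)
    (s : List (I ⊕ J)) (c : ℂ) : Prop :=
  ∃ P, IsCumulantPolynomial s P ∧ MvPolynomial.eval (moment γ) P = c

/-- `γ` is a bi-free central limit distribution: a distribution whose bi-free cumulants of order
one and of order at least three vanish. -/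
def IsCentralLimit {I : Type u} {J : Type v} (γ : FreeAlgebra ℂ (I ⊕ J) →ₗ[ℂ] ℂ) : Prop :=
  γ 1 = 1 ∧ ∀ s : List (I ⊕ J), s.length = 1 ∨ 3 ≤ s.length → HasCumulant γ s 0

/-! ### The full Fock space -/

/-- An inner product space, bundled. -/
structure PreHilbert where
  carrier : Type u
  [grp : NormedAddCommGroup carrier]
  [ips : InnerProductSpace ℂ carrier]

attribute [instance] PreHilbert.grp PreHilbert.ips

section Fock

variable (H : Type u) [NormedAddCommGroup H] [InnerProductSpace ℂ H]

/-- The algebraic tensor power `H ⊗ (H ⊗ ⋯ (H ⊗ ℂ))` as an inner product space. -/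
def tensorPow : ℕ → PreHilbert.{u}
  | 0 => ⟨EuclideanSpace ℂ PUnit.{u + 1}⟩
  | n + 1 => ⟨H ⊗[ℂ] (tensorPow n).carrier⟩

/-- The Hilbert space tensor power `H^{⊗ n}`. -/
abbrev HilbertPow (n : ℕ) : Type u := UniformSpace.Completion (tensorPow H n).carrier

/-- The full Fock space, the Hilbert space direct sum of the `H^{⊗ n}`, `n ≥ 0`. -/
abbrev Fock : Type u := lp (fun n => HilbertPow H n) 2

/-- The unit `1` of the zeroth tensor power `ℂ`. -/
def tensorUnit : (tensorPow H 0).carrier :=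
  (EuclideanSpace.single PUnit.unit (1 : ℂ) : EuclideanSpace ℂ PUnit.{u + 1})

/-- The vacuum vector, the unit vector of `H^{⊗ 0} = ℂ`. -/
def fockVacuum : Fock H :=
  lp.single 2 0 (tensorUnit H : HilbertPow H 0)

variable {H}

/-- `ζ ↦ h ⊗ ζ` on the algebraic tensor power. -/
def consLin (h : H) (n : ℕ) : (tensorPow H n).carrier →ₗ[ℂ] (tensorPow H (n + 1)).carrier :=
  TensorProduct.mk ℂ H (tensorPow H n).carrier h

/-- `ζ ↦ ζ ⊗ h` on the algebraic tensor power. -/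
def snocLin (h : H) : ∀ n, (tensorPow H n).carrier →ₗ[ℂ] (tensorPow H (n + 1)).carrier
  | 0 => consLin h 0
  | n + 1 => LinearMap.lTensor H (snocLin h n)

theorem norm_consLin (h : H) (n : ℕ) (t : (tensorPow H n).carrier) :
    ‖consLin h n t‖ = ‖h‖ * ‖t‖ :=
  TensorProduct.norm_tmul h t

theorem inner_snocLin (h : H) (n : ℕ) (s t : (tensorPow H n).carrier) :
    inner ℂ (snocLin h n s) (snocLin h n t) = inner ℂ h h * inner ℂ s t := by
  induction n with
  | zero => exact TensorProduct.inner_tmul (𝕜 := ℂ) h h s t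
  | succ n ih =>
    change inner ℂ (LinearMap.lTensor H (snocLin h n) s) (LinearMap.lTensor H (snocLin h n) t) = _
    change H ⊗[ℂ] (tensorPow H n).carrier at s t
    change _ = inner ℂ h h * inner ℂ (E := H ⊗[ℂ] (tensorPow H n).carrier) s t
    induction s using TensorProduct.induction_on with
    | zero => simp
    | add a b ha hb => rw [map_add, inner_add_left, inner_add_left, ha, hb, mul_add]
    | tmul a b =>
      induction t using TensorProduct.induction_on with
      | zero => simp
      | add c d hc hd => rw [map_add, inner_add_right, inner_add_right, hc, hd, mul_add]
      | tmul c d =>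
        rw [LinearMap.lTensor_tmul, LinearMap.lTensor_tmul]
        refine (TensorProduct.inner_tmul (𝕜 := ℂ) a c _ _).trans ?_
        rw [ih, TensorProduct.inner_tmul]
        ring

theorem norm_snocLin (h : H) (n : ℕ) (t : (tensorPow H n).carrier) :
    ‖snocLin h n t‖ = ‖h‖ * ‖t‖ := by
  have h1 := inner_snocLin h n t t
  simp only [inner_self_eq_norm_sq_to_K] at h1
  have h2 : ‖snocLin h n t‖ ^ 2 = (‖h‖ * ‖t‖) ^ 2 := by
    rw [mul_pow]
    exact_mod_cast h1
  exact (pow_left_inj₀ (norm_nonneg _) (by positivity) two_ne_zero).1 h2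

/-- `ζ ↦ h ⊗ ζ` from `H^{⊗ n}` to `H^{⊗ (n + 1)}`. -/
def consPow (h : H) (n : ℕ) : HilbertPow H n →L[ℂ] HilbertPow H (n + 1) :=
  ((consLin h n).mkContinuous ‖h‖ fun t => (norm_consLin h n t).le).completion

/-- `ζ ↦ ζ ⊗ h` from `H^{⊗ n}` to `H^{⊗ (n + 1)}`. -/
def snocPow (h : H) (n : ℕ) : HilbertPow H n →L[ℂ] HilbertPow H (n + 1) :=
  ((snocLin h n).mkContinuous ‖h‖ fun t => (norm_snocLin h n t).le).completion

theorem norm_consPow (h : H) (n : ℕ) (t : HilbertPow H n) : ‖consPow h n t‖ = ‖h‖ * ‖t‖ := by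
  induction t using UniformSpace.Completion.induction_on with
  | hp => exact isClosed_eq (by fun_prop) (by fun_prop)
  | ih a =>
    rw [consPow, ContinuousLinearMap.completion_apply_coe, UniformSpace.Completion.norm_coe,
      UniformSpace.Completion.norm_coe]
    exact norm_consLin h n a

theorem norm_snocPow (h : H) (n : ℕ) (t : HilbertPow H n) : ‖snocPow h n t‖ = ‖h‖ * ‖t‖ := by
  induction t using UniformSpace.Completion.induction_on with
  | hp => exact isClosed_eq (by fun_prop) (by fun_prop)
  | ih a =>
    rw [snocPow, ContinuousLinearMap.completion_apply_coe, UniformSpace.Completion.norm_coe,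
      UniformSpace.Completion.norm_coe]
    exact norm_snocLin h n a

/-- The sequence `(0, S 0 f₀, S 1 f₁, …)`. -/
def shiftFun (S : ∀ n, HilbertPow H n →L[ℂ] HilbertPow H (n + 1)) (f : ∀ n, HilbertPow H n) :
    ∀ n, HilbertPow H n
  | 0 => 0
  | n + 1 => S n (f n)

theorem hasSum_shiftFun (S : ∀ n, HilbertPow H n →L[ℂ] HilbertPow H (n + 1)) (C : ℝ)
    (hS : ∀ n t, ‖S n t‖ = C * ‖t‖) (f : Fock H) :
    HasSum (fun n => ‖shiftFun S f n‖ ^ (2 : ENNReal).toReal)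
      (C ^ 2 * ‖f‖ ^ (2 : ENNReal).toReal) := by
  have h := (lp.hasSum_norm (p := 2) (by simp) f).mul_left (C ^ 2)
  rw [hasSum_nat_add_iff' 1 |>.symm]
  simpa [shiftFun, hS, mul_pow] using h

/-- The bounded operator `(f₀, f₁, …) ↦ (0, S 0 f₀, S 1 f₁, …)` on the full Fock space, for maps
`S n` that multiply norms by the constant `C`. -/
def shift (S : ∀ n, HilbertPow H n →L[ℂ] HilbertPow H (n + 1)) (C : ℝ) (hC : 0 ≤ C)
    (hS : ∀ n t, ‖S n t‖ = C * ‖t‖) : Fock H →L[ℂ] Fock H :=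
  LinearMap.mkContinuous
    { toFun := fun f => ⟨shiftFun S f, memℓp_gen (hasSum_shiftFun S C hS f).summable⟩
      map_add' := fun f g => by
        ext n
        change shiftFun S (f + g : Fock H) n = shiftFun S f n + shiftFun S g n
        cases n <;> simp [shiftFun]
      map_smul' := fun c f => by
        ext n
        cases n <;> simp [shiftFun] } C fun f => by
    refine lp.norm_le_of_tsum_le (by simp) (by positivity) ?_
    refine (hasSum_shiftFun S C hS f).tsum_eq.le.trans (le_of_eq ?_)
    simp [mul_pow]

/-- The left creation operator `l(h) ζ = h ⊗ ζ`. -/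
def leftCreation (h : H) : Fock H →L[ℂ] Fock H :=
  shift (consPow h) ‖h‖ (norm_nonneg h) (norm_consPow h)

/-- The right creation operator `r(h) ζ = ζ ⊗ h`. -/
def rightCreation (h : H) : Fock H →L[ℂ] Fock H :=
  shift (snocPow h) ‖h‖ (norm_nonneg h) (norm_snocPow h)

variable (H) in
/-- The vacuum state `T ↦ ⟨T 1, 1⟩` on the bounded operators of the full Fock space (`inner` is
linear in its second argument). -/
def fockState : (Fock H →L[ℂ] Fock H) →ₗ[ℂ] ℂ where
  toFun T := inner ℂ (fockVacuum H) (T (fockVacuum H))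
  map_add' S T := by simp
  map_smul' c T := by simp

/-- The two-faced family `z_i = l(h(i)) + l(h*(i))^*` (left), `z_j = r(h(j)) + r(h*(j))^*`
(right). -/
def fockFamily {I : Type v} {J : Type w} (h hstar : I ⊕ J → H) : I ⊕ J → (Fock H →L[ℂ] Fock H)
  | Sum.inl i => leftCreation (h (Sum.inl i)) +
      ContinuousLinearMap.adjoint (leftCreation (hstar (Sum.inl i)))
  | Sum.inr j => rightCreation (h (Sum.inr j)) +
      ContinuousLinearMap.adjoint (rightCreation (hstar (Sum.inr j)))

end Fock
end BiFree

end

/-! The candidate for the limit is explicit. On the span of the words in `I ⊕ J`, an algebraic full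
Fock space, let the variable `a` create the letter `a` and annihilate a letter `b` with weight `C a
b`, on the left or on the right according to its face. The vacuum distribution `gaussian C` has
covariance `C`. The free product of two such spaces embeds in the Fock space over two-coloured
letters (`vacuumCoeff_fockSpace`), where the diagonal embedding shows that the sum of two bi-free
copies is distributed like `√2` times one copy (`counit_sum_fockOp`). For the value `R` of a
cumulant polynomial of a word of length `n`, additivity and homogeneity now give `2 R = (√2)^n R`,
hence `R = 0` unless `n = 2`.

Conversely, a cumulant is the moment of its word plus a polynomial in the moments of proper
subwords, so second moments and the vanishing of all other cumulants determine every moment by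
induction on the length (`eq_gaussian`). One polynomial is evaluated at both distributions, so
uniqueness of cumulant polynomials plays no role.

Their existence does. With `ω` a primitive `n`-th root of unity, take `1 / n` times the moment of
the word in `ω z⁽¹⁾ + ⋯ + ωⁿ z⁽ⁿ⁾`, for bi-free copies of `z`. Expanding over colourings of the word
gives mixed moments, which are universal polynomials in the moments of `z` (`mixed`,
`vacuumCoeff_prod_eq_mixed`). Constant colourings contribute the moment of the whole word, all
others only moments of proper subwords. For additivity, associativity of the free product
(`vacuumCoeff_copies`) turns copies of `z' + z''` into `2n` bi-free families. Shifting the copies of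
`z'` cyclically multiplies the part with `c` letters from `z'` by `ω^c`, so only `c = 0` and `c = n`
survive (`rootSum_mixed_eq_zero`, `rootSum_sumMoment`).

On the Hilbert space side, sending words to elementary tensors intertwines the two models and
preserves the vacuum expectation (`fockMap_fockOp`, `inner_fockVacuum_fockMap`). A finite matrix is
realized by a standard basis and the columns of the matrix. -/

noncomputable section

namespace BiFree

/-! ### Words acting from the left and from the right -/

section Faces

variable {I J P Q : Type*}

/-- Attach `p` to the list on the side of the face of `a`: at the front if `a` is a left index, at
the end if `a` is a right index. -/
def attach (a : I ⊕ J) (p : P) (l : List P) : List P :=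
  a.elim (fun _ => p :: l) (fun _ => l ++ [p])

/-- Split off the first or last element of a list, on the side of the face of `a`. -/
def detach (a : I ⊕ J) (l : List P) : Option (P × List P) :=
  a.elim (fun _ => match l with | [] => none | p :: t => some (p, t))
    (fun _ => match l.reverse with | [] => none | p :: t => some (p, t.reverse))

theorem detach_nil (a : I ⊕ J) : detach a ([] : List P) = none := by
  cases a <;> rfl

theorem detach_attach (a : I ⊕ J) (p : P) (l : List P) :
    detach a (attach a p l) = some (p, l) := by
  cases a <;> simp [attach, detach]

theorem attach_ne_nil (a : I ⊕ J) (p : P) (l : List P) : attach a p l ≠ [] := by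
  cases a <;> simp [attach]

theorem nil_or_attach (a : I ⊕ J) (l : List P) : l = [] ∨ ∃ p t, l = attach a p t := by
  cases a with
  | inl i => cases l with
    | nil => simp
    | cons p t => exact Or.inr ⟨p, t, rfl⟩
  | inr j =>
    rcases List.eq_nil_or_concat' l with rfl | ⟨t, p, rfl⟩
    · simp
    · exact Or.inr ⟨p, t, rfl⟩

theorem map_attach (f : P → Q) (a : I ⊕ J) (p : P) (l : List P) :
    (attach a p l).map f = attach a (f p) (l.map f) := by
  cases a <;> simp [attach]

theorem mem_attach {a : I ⊕ J} {p q : P} {l : List P} : q ∈ attach a p l ↔ q = p ∨ q ∈ l := by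
  cases a <;> simp [attach, or_comm]

theorem sum_map_attach (f : P → ℕ) (a : I ⊕ J) (p : P) (l : List P) :
    ((attach a p l).map f).sum = f p + (l.map f).sum := by
  cases a <;> simp [attach, add_comm]

end Faces

/-! ### Mixed moments of bi-free families -/

section Mixed

variable {I J : Type*} {K K' : Type*} [DecidableEq K] [DecidableEq K'] {R R' : Type*} [CommRing R]
  [CommRing R']

/-- The coefficient of the vacuum after applying the coloured variables `ops` (the head of the list
being applied first) to an elementary tensor, whose legs are the centred words in the list `st`.
`m k w` is the moment of the word `w` in the variables of colour `k`. -/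
def mixed (m : K → List (I ⊕ J) → R) : List (K × (I ⊕ J)) → List (K × List (I ⊕ J)) → R
  | [], st => if st = [] then 1 else 0
  | (k, a) :: ops, st =>
    match detach a st with
    | none => m k [a] * mixed m ops st + mixed m ops (attach a (k, [a]) st)
    | some ((j, w), t) =>
      if j = k then
        m k (a :: w) * mixed m ops t + mixed m ops (attach a (k, a :: w) t) -
          m k w * (m k [a] * mixed m ops t + mixed m ops (attach a (k, [a]) t))
      else m k [a] * mixed m ops st + mixed m ops (attach a (k, [a]) st)

variable (m : K → List (I ⊕ J) → R)

theorem mixed_cons_nil (k : K) (a : I ⊕ J) (ops : List (K × (I ⊕ J))) :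
    mixed m ((k, a) :: ops) [] =
      m k [a] * mixed m ops [] + mixed m ops (attach a (k, [a]) []) := by
  simp [mixed, detach_nil]

/-- The leg stands for `T_w ξ - m(w) ξ`. Applying `T_a` gives `T_a T_w ξ` minus `m(w)` times `T_a
ξ`, and each of these vectors is split into its mean and its centred part. -/
theorem mixed_cons_same (k : K) (a : I ⊕ J) (ops : List (K × (I ⊕ J))) (w : List (I ⊕ J))
    (t : List (K × List (I ⊕ J))) :
    mixed m ((k, a) :: ops) (attach a (k, w) t) =
      m k (a :: w) * mixed m ops t + mixed m ops (attach a (k, a :: w) t) -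
          m k w * (m k [a] * mixed m ops t + mixed m ops (attach a (k, [a]) t)) := by
  simp [mixed, detach_attach]

theorem mixed_cons_ne {j k : K} (h : j ≠ k) (a : I ⊕ J) (ops : List (K × (I ⊕ J)))
    (w : List (I ⊕ J)) (t : List (K × List (I ⊕ J))) :
    mixed m ((k, a) :: ops) (attach a (j, w) t) =
      m k [a] * mixed m ops (attach a (j, w) t) +
        mixed m ops (attach a (k, [a]) (attach a (j, w) t)) := by
  simp [mixed, detach_attach, h]

/-- Induction principle following the recursion of `mixed`. -/
@[elab_as_elim]
theorem mixed_induction {p : List (K × (I ⊕ J)) → List (K × List (I ⊕ J)) → Prop}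
    (nil : ∀ st, p [] st)
    (cons_nil : ∀ k a ops, (∀ st, p ops st) → p ((k, a) :: ops) [])
    (cons_same : ∀ k a ops w t, (∀ st, p ops st) → p ((k, a) :: ops) (attach a (k, w) t))
    (cons_ne : ∀ k a ops j w t, j ≠ k → (∀ st, p ops st) →
      p ((k, a) :: ops) (attach a (j, w) t)) (ops : List (K × (I ⊕ J)))
    (st : List (K × List (I ⊕ J))) : p ops st := by
  revert st
  induction ops with
  | nil => exact nil
  | cons q ops ih =>
    obtain ⟨k, a⟩ := q
    intro st
    rcases nil_or_attach a st with rfl | ⟨⟨j, w⟩, t, rfl⟩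
    · exact cons_nil k a ops ih
    · by_cases h : j = k
      · subst h
        exact cons_same j a ops w t ih
      · exact cons_ne k a ops j w t h ih

/-- The recursion uses ring operations only. This specializes the generic polynomial, with words as
indeterminates, to actual moments. -/
theorem map_mixed (f : R →+* R') (ops : List (K × (I ⊕ J))) : ∀ st : List (K × List (I ⊕ J)),
    f (mixed m ops st) = mixed (fun k w => f (m k w)) ops st := by
  intro st
  refine mixed_induction ?_ ?_ ?_ ?_ ops st <;> clear st ops
  · intro st
    by_cases h : st = [] <;> simp [mixed, h]
  · intro k a ops ih
    simp [mixed_cons_nil, ih]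
  · intro k a ops w t ih
    simp [mixed_cons_same, ih]
  · intro k a ops j w t h ih
    simp [mixed_cons_ne _ h, ih]

/-- The recursion only compares colours for equality, so an injective relabelling is invisible to
it. -/
theorem mixed_map_colour {f : K → K'} (hf : Function.Injective f) (m : K' → List (I ⊕ J) → R)
    (ops : List (K × (I ⊕ J))) : ∀ st : List (K × List (I ⊕ J)),
    mixed m (ops.map (Prod.map f id)) (st.map (Prod.map f id)) =
      mixed (fun k w => m (f k) w) ops st := by
  intro st
  refine mixed_induction ?_ ?_ ?_ ?_ ops st <;> clear st ops
  · intro st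
    simp [mixed]
  · intro k a ops ih
    have h := ih (attach a (k, [a]) [])
    have h' := ih []
    rw [map_attach] at h
    simp only [List.map_cons, List.map_nil, Prod.map, id, mixed_cons_nil] at h h' ⊢
    rw [h, h']
  · intro k a ops w t ih
    have h1 := ih t
    have h2 := ih (attach a (k, a :: w) t)
    have h3 := ih (attach a (k, [a]) t)
    rw [map_attach] at h2 h3
    simp only [List.map_cons, map_attach, Prod.map, id, mixed_cons_same] at h1 h2 h3 ⊢
    rw [h1, h2, h3]
  · intro k a ops j w t h ih
    have h1 := ih (attach a (j, w) t)
    have h2 := ih (attach a (k, [a]) (attach a (j, w) t))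
    simp only [List.map_cons, map_attach, Prod.map, id, mixed_cons_ne _ h,
      mixed_cons_ne _ (hf.ne h)] at h1 h2 ⊢
    rw [h1, h2]

/-- With a single colour there is never more than one leg. The second claim, needed for the
induction, restores the subtracted mean: it computes the expectation on the uncentred vector `T_w
ξ`. -/
theorem mixed_replicate (k : K) (hm : m k [] = 1) (ops : List (I ⊕ J)) :
    mixed m (ops.map (Prod.mk k)) [] = m k ops.reverse ∧ ∀ (a : I ⊕ J) w,
      mixed m (ops.map (Prod.mk k)) (attach a (k, w) []) +
        m k w * mixed m (ops.map (Prod.mk k)) [] = m k (ops.reverse ++ w) := by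
  induction ops with
  | nil => simp [mixed, attach_ne_nil, hm]
  | cons b ops ih =>
    have key : mixed m ((b :: ops).map (Prod.mk k)) [] = m k (b :: ops).reverse := by
      rw [List.map_cons, mixed_cons_nil]
      have := ih.2 b [b]
      rw [List.reverse_cons, ← this]
      ring
    refine ⟨key, fun a w => ?_⟩
    -- Next to the empty list both faces attach alike, so the leg may be taken to lie on the side of
    -- the next letter `b`.
    have h0 : ∀ q : K × List (I ⊕ J), attach a q [] = attach b q [] := by
      intro q; cases a <;> cases b <;> rfl
    rw [h0, List.map_cons, mixed_cons_same, mixed_cons_nil]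
    have h1 := ih.2 b (b :: w)
    rw [List.reverse_cons, List.append_assoc, List.singleton_append, ← h1]
    ring

end Mixed

/-! ### The generic mixed moments -/

section Generic

open MvPolynomial

variable {I J : Type*} {K : Type*} [DecidableEq K]

/-- The word `w` as an indeterminate, the empty word being `1`. -/
def wordVar (w : List (I ⊕ J)) : MvPolynomial (List (I ⊕ J)) ℂ :=
  if w = [] then 1 else X w

theorem eval_wordVar {m : List (I ⊕ J) → ℂ} (hm : m [] = 1) (w : List (I ⊕ J)) :
    eval m (wordVar w) = m w := by
  by_cases h : w = [] <;> simp [wordVar, h, hm]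

/-- The letters of colour `k` of a coloured word. -/
def restrict (k : K) (l : List (K × (I ⊕ J))) : List (I ⊕ J) :=
  l.filterMap fun p => if p.1 = k then some p.2 else none

theorem restrict_append (k : K) (l l' : List (K × (I ⊕ J))) :
    restrict k (l ++ l') = restrict k l ++ restrict k l' := by
  simp [restrict]

theorem restrict_sublist (k : K) (l : List (K × (I ⊕ J))) :
    (restrict k l).Sublist (l.map Prod.snd) := by
  induction l with
  | nil => simp [restrict]
  | cons p l ih =>
    by_cases h : p.1 = k
    · simpa [restrict, h] using ih
    · simpa [restrict, h] using ih.trans (List.sublist_cons_self _ _)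

theorem restrict_length (k : K) (l : List (K × (I ⊕ J))) :
    (restrict k l).length = l.length ↔ ∀ p ∈ l, p.1 = k := by
  induction l with
  | nil => simp [restrict]
  | cons p l ih =>
    have h1 : (restrict k l).length ≤ l.length := by
      simpa using (restrict_sublist k l).length_le
    by_cases h : p.1 = k
    · have : (restrict k (p :: l)).length = (restrict k l).length + 1 := by simp [restrict, h]
      simp [this, ih, h]
    · have : (restrict k (p :: l)).length = (restrict k l).length := by simp [restrict, h]
      simp [this, h]
      omega

/-- `past` records the letters already applied, the latest first. The invariant is that the word of
each leg is a subword of the past letters of its own colour; hence only moments of one-coloured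
subwords occur. -/
theorem mixed_wordVar_mem_supported (ops : List (K × (I ⊕ J))) :
    ∀ (st : List (K × List (I ⊕ J))) (past : List (K × (I ⊕ J))),
    (∀ p ∈ st, p.2.Sublist (restrict p.1 past)) →
    mixed (fun _ w => wordVar w) ops st ∈
      supported ℂ {t : List (I ⊕ J) | t ≠ [] ∧ ∃ k, t.Sublist (restrict k (ops.reverse ++ past))} := by
  have hvar : ∀ (L : List (K × (I ⊕ J))) (k : K) (w : List (I ⊕ J)), w.Sublist (restrict k L) →
      wordVar w ∈ supported ℂ {t : List (I ⊕ J) | t ≠ [] ∧ ∃ k, t.Sublist (restrict k L)} := by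
    intro L k w hw
    unfold wordVar
    split_ifs with h
    · exact one_mem _
    · exact (X_mem_supported (R := ℂ)).2 ⟨h, k, hw⟩
  have hstep : ∀ (k : K) (a : I ⊕ J) (past : List (K × (I ⊕ J))) (w : List (I ⊕ J)) j,
      w.Sublist (restrict j past) → w.Sublist (restrict j ((k, a) :: past)) := by
    intro k a past w j h
    refine h.trans ?_
    rw [← List.singleton_append, restrict_append]
    exact List.sublist_append_right _ _
  have hnew : ∀ (k : K) (a : I ⊕ J) (past : List (K × (I ⊕ J))) (w : List (I ⊕ J)),
      w.Sublist (restrict k past) → (a :: w).Sublist (restrict k ((k, a) :: past)) := by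
    intro k a past w h
    have : restrict k ((k, a) :: past) = a :: restrict k past := by simp [restrict]
    rw [this]
    exact h.cons_cons a
  have hold : ∀ (L past : List (K × (I ⊕ J))) (w : List (I ⊕ J)) j,
      w.Sublist (restrict j past) → w.Sublist (restrict j (L ++ past)) := by
    intro L past w j h
    rw [restrict_append]
    exact h.trans (List.sublist_append_right _ _)
  intro st
  refine mixed_induction ?_ ?_ ?_ ?_ ops st <;> clear st ops
  · intro st past _
    unfold mixed
    split_ifs
    · exact one_mem _
    · exact zero_mem _
  · intro k a ops ih past _
    rw [mixed_cons_nil, List.reverse_cons, List.append_assoc, List.singleton_append]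
    refine add_mem (mul_mem (hvar _ k _ (hold _ _ _ _ (hnew k a past [] (by simp)))) ?_) ?_
    · exact ih _ _ (by simp)
    · refine ih _ _ fun p hp => ?_
      rw [mem_attach] at hp
      rcases hp with rfl | hp
      · exact hnew k a past [] (by simp)
      · simp at hp
  · intro k a ops w t ih past hst
    have hw : w.Sublist (restrict k past) := hst (k, w) (mem_attach.2 (Or.inl rfl))
    have ht : ∀ p ∈ t, p.2.Sublist (restrict p.1 ((k, a) :: past)) := fun p hp =>
      hstep _ _ _ _ _ (hst p (mem_attach.2 (Or.inr hp)))
    have hatt : ∀ v : List (I ⊕ J), v.Sublist (restrict k past) →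
        ∀ p ∈ attach a (k, a :: v) t, p.2.Sublist (restrict p.1 ((k, a) :: past)) := by
      intro v hv p hp
      rcases mem_attach.1 hp with rfl | hp
      · exact hnew k a past v hv
      · exact ht p hp
    rw [mixed_cons_same, List.reverse_cons, List.append_assoc, List.singleton_append]
    refine sub_mem (add_mem (mul_mem (hvar _ k _ (hold _ _ _ _ (hnew k a past w hw)))
      (ih _ _ ht)) (ih _ _ (hatt w hw))) (mul_mem (hvar _ k _ (hold _ _ _ _ (hstep _ _ _ _ _ hw)))
      (add_mem (mul_mem (hvar _ k _ (hold _ _ _ _ (hnew k a past [] (by simp)))) (ih _ _ ht))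
        (ih _ _ (hatt [] (by simp)))))
  · intro k a ops j w t h ih past hst
    have ht : ∀ p ∈ attach a (j, w) t, p.2.Sublist (restrict p.1 ((k, a) :: past)) := fun p hp =>
      hstep _ _ _ _ _ (hst p hp)
    rw [mixed_cons_ne _ h, List.reverse_cons, List.append_assoc, List.singleton_append]
    refine add_mem (mul_mem (hvar _ k _ (hold _ _ _ _ (hnew k a past [] (by simp))))
      (ih _ _ ht)) (ih _ _ fun p hp => ?_)
    rcases mem_attach.1 hp with rfl | hp
    · exact hnew k a past [] (by simp)
    · exact ht p hp

theorem wordVar_isWeightedHomogeneous (w : List (I ⊕ J)) :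
    IsWeightedHomogeneous (fun t : List (I ⊕ J) => t.length) (wordVar w) w.length := by
  unfold wordVar
  split_ifs with h
  · subst h
    exact isWeightedHomogeneous_one ℂ _
  · exact isWeightedHomogeneous_X ℂ (fun t : List (I ⊕ J) => t.length) w

/-- The letters still to be applied and those held in legs are counted together: each step moves
letters into legs or into moments and loses none. -/
theorem mixed_wordVar_isWeightedHomogeneous (ops : List (K × (I ⊕ J))) :
    ∀ st : List (K × List (I ⊕ J)),
    IsWeightedHomogeneous (fun t : List (I ⊕ J) => t.length)
      (mixed (fun _ w => wordVar w) ops st)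
      (ops.length + (st.map fun p => p.2.length).sum) := by
  have hmul : ∀ {p q : MvPolynomial (List (I ⊕ J)) ℂ} {c d e : ℕ},
      IsWeightedHomogeneous (fun t : List (I ⊕ J) => t.length) p c →
      IsWeightedHomogeneous (fun t : List (I ⊕ J) => t.length) q d → c + d = e →
      IsWeightedHomogeneous (fun t : List (I ⊕ J) => t.length) (p * q) e := by
    intro p q c d e hp hq h
    exact h ▸ hp.mul hq
  have hcast : ∀ {p : MvPolynomial (List (I ⊕ J)) ℂ} {c d : ℕ},
      IsWeightedHomogeneous (fun t : List (I ⊕ J) => t.length) p c → c = d →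
      IsWeightedHomogeneous (fun t : List (I ⊕ J) => t.length) p d := by
    intro p c d hp h
    exact h ▸ hp
  intro st
  refine mixed_induction ?_ ?_ ?_ ?_ ops st <;> clear st ops
  · intro st
    unfold mixed
    split_ifs with h
    · subst h
      exact isWeightedHomogeneous_one ℂ _
    · exact isWeightedHomogeneous_zero ℂ _ _
  · intro k a ops ih
    rw [mixed_cons_nil]
    refine (hmul (wordVar_isWeightedHomogeneous _) (ih _) ?_).add (hcast (ih _) ?_)
    · simp [add_comm]
    · simp [sum_map_attach]
  · intro k a ops w t ih
    rw [mixed_cons_same]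
    refine ((hmul (wordVar_isWeightedHomogeneous _) (ih _) ?_).add (hcast (ih _) ?_)).sub
      (hmul (wordVar_isWeightedHomogeneous _) ((hmul (wordVar_isWeightedHomogeneous _) (ih _)
        rfl).add (hcast (ih _) ?_)) ?_)
    all_goals simp [sum_map_attach]
    all_goals omega
  · intro k a ops j w t h ih
    rw [mixed_cons_ne _ h]
    refine (hmul (wordVar_isWeightedHomogeneous _) (ih _) ?_).add (hcast (ih _) ?_)
    all_goals simp [sum_map_attach]
    all_goals omega

end Generic

/-! ### Left and right multiplication and left and right operators -/

section FaceMul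

variable {I J : Type*} {B B' : Type*} [Ring B] [Algebra ℂ B] [Ring B'] [Algebra ℂ B']

/-- Multiplication from the left for a left index, from the right for a right index. -/
def faceMul (a : I ⊕ J) : B →ₗ[ℂ] B →ₗ[ℂ] B :=
  a.elim (fun _ => LinearMap.mul ℂ B) (fun _ => (LinearMap.mul ℂ B).flip)

theorem faceMul_assoc (a : I ⊕ J) (x y t : B) :
    faceMul a (faceMul a x y) t = faceMul a x (faceMul a y t) := by
  cases a <;> simp [faceMul, mul_assoc]

theorem faceMul_one (a : I ⊕ J) (x : B) : faceMul a x 1 = x := by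
  cases a <;> simp [faceMul]

theorem one_faceMul (a : I ⊕ J) (x : B) : faceMul a 1 x = x := by
  cases a <;> simp [faceMul]

theorem map_faceMul (f : B →ₐ[ℂ] B') (a : I ⊕ J) (x t : B) :
    f (faceMul a x t) = faceMul a (f x) (f t) := by
  cases a <;> simp [faceMul]

end FaceMul

section FaceOperators

variable {I J : Type*} {K : Type x} [DecidableEq K] (X : K → StateSpace.{u})

/-- The operator `λ_k(T)` or `ρ_k(T)` on tensors, according to the face of `a`. -/
def faceTensor (a : I ⊕ J) (k : K) (T : Module.End ℂ (X k).carrier) :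
    Tensors X →ₗ[ℂ] Tensors X :=
  a.elim (fun _ => leftTensor X k T) (fun _ => rightTensor X k T)

/-- The operator `λ_k(T)` or `ρ_k(T)` on the free product, according to the face of `a`. -/
def faceOp (a : I ⊕ J) (k : K) (T : Module.End ℂ (X k).carrier) :
    Module.End ℂ (FreeProduct X) :=
  a.elim (fun _ => leftOp X k T) (fun _ => rightOp X k T)

theorem coe_faceOp (a : I ⊕ J) (k : K) (T : Module.End ℂ (X k).carrier) (t : FreeProduct X) :
    (faceOp X a k T t : Tensors X) = faceTensor X a k T t := by
  cases a <;> rfl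

theorem faceTensor_one (a : I ⊕ J) (k : K) (T : Module.End ℂ (X k).carrier) :
    faceTensor X a k T 1 = incl X k (T (X k).ξ) := by
  cases a
  · exact leftTensor_one X k T
  · exact rightTensor_one X k T

theorem faceTensor_same (a : I ⊕ J) (k : K) (T : Module.End ℂ (X k).carrier) (y : (X k).ker₀)
    (t : Tensors X) :
    faceTensor X a k T (faceMul a (letter X k y) t) = faceMul a (incl X k (T y)) t := by
  cases a
  · exact leftTensor_same X k T y t
  · exact rightTensor_same X k T y t

theorem faceTensor_ne {j k : K} (h : j ≠ k) (a : I ⊕ J) (T : Module.End ℂ (X k).carrier)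
    (y : (X j).ker₀) (t : Tensors X) :
    faceTensor X a k T (faceMul a (letter X j y) t) =
      faceMul a (incl X k (T (X k).ξ)) (faceMul a (letter X j y) t) := by
  cases a
  · exact leftTensor_ne X h T y t
  · exact rightTensor_ne X h T y t

/-- Linear maps on tensors agree if they agree on the empty tensor and on all tensors with a first
(last) leg. -/
theorem tensors_ext {M : Type*} [AddCommGroup M] [Module ℂ M] (a : I ⊕ J)
    {f g : Tensors X →ₗ[ℂ] M} (h1 : f 1 = g 1)
    (h2 : ∀ k (y : (X k).ker₀) t,
      f (faceMul a (letter X k y) t) = g (faceMul a (letter X k y) t)) : f = g := by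
  have hι : ∀ v t, f (faceMul a (TensorAlgebra.ι ℂ v) t) =
      g (faceMul a (TensorAlgebra.ι ℂ v) t) := by
    intro v t
    induction v using DirectSum.induction_on with
    | zero => simp
    | of k y => exact h2 k y t
    | add v w hv hw => simp only [map_add, LinearMap.add_apply, hv, hw]
  have key : ∀ s t, f t = g t → f (faceMul a s t) = g (faceMul a s t) := by
    intro s
    induction s using TensorAlgebra.induction with
    | algebraMap r =>
      intro t ht
      rw [Algebra.algebraMap_eq_smul_one, map_smul, LinearMap.smul_apply, one_faceMul, map_smul,
        map_smul, ht]
    | ι v => exact fun t _ => hι v t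
    | mul x y hx hy =>
      intro t ht
      cases a with
      | inl i => simpa [faceMul, mul_assoc] using hx _ (hy t ht)
      | inr j => simpa [faceMul, mul_assoc] using hy _ (hx t ht)
    | add x y hx hy =>
      intro t ht
      simp only [map_add, LinearMap.add_apply, hx t ht, hy t ht]
  refine LinearMap.ext fun s => ?_
  simpa [faceMul_one] using key s 1 h1

/-- The coefficient of the empty tensor. -/
abbrev vacuumCoeff : Tensors X →ₐ[ℂ] ℂ :=
  TensorAlgebra.algebraMapInv (R := ℂ) (M := Letters X)

theorem vacuumCoeff_letter (k : K) (y : (X k).ker₀) : vacuumCoeff X (letter X k y) = 0 := by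
  simp [letter, TensorAlgebra.algebraMapInv]

theorem vacuumCoeff_incl (k : K) (y : (X k).carrier) :
    vacuumCoeff X (incl X k y) = (X k).ψ y := by
  rw [incl_apply, map_add, vacuumCoeff_letter, map_smul, map_one]
  simp

theorem incl_ξ (k : K) : incl X k (X k).ξ = 1 := by
  have : (X k).proj₀ (X k).ξ = 0 := by
    ext
    simp [StateSpace.coe_proj₀, (X k).ψ_ξ]
  simp [incl_apply, this, (X k).ψ_ξ, letter]

theorem incl_of_ψ_eq_zero {k : K} {y : (X k).carrier} (h : (X k).ψ y = 0) :
    incl X k y = letter X k ⟨y, h⟩ := by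
  have : (X k).proj₀ y = ⟨y, h⟩ := by
    ext
    simp [StateSpace.coe_proj₀, h]
  simp [incl_apply, h, this]

theorem vacuumCoeff_faceMul_letter (a : I ⊕ J) (k : K) (y : (X k).ker₀) (t : Tensors X) :
    vacuumCoeff X (faceMul a (letter X k y) t) = 0 := by
  rw [map_faceMul, vacuumCoeff_letter]
  simp

theorem coe_prod_apply {A : Type*} (op : A → Module.End ℂ (FreeProduct X))
    (op' : A → Module.End ℂ (Tensors X)) (h : ∀ p t, (op p t : Tensors X) = op' p t)
    (l : List A) (t : FreeProduct X) :
    ((l.map op).prod t : Tensors X) = (l.map op').prod (t : Tensors X) := by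
  induction l with
  | nil => rfl
  | cons p l ih => simp [h, ih]

theorem vacuumState_apply (T : Module.End ℂ (FreeProduct X)) :
    vacuumState X T = vacuumCoeff X (T (vacuum X) : Tensors X) := rfl

/-- The free product, as a vector space with specified state vector. -/
def freeProductSpace : StateSpace.{max x u} where
  carrier := FreeProduct X
  ξ := vacuum X
  ψ := (vacuumCoeff X).toLinearMap ∘ₗ (FreeProduct X).subtype
  ψ_ξ := map_one (vacuumCoeff X)

end FaceOperators

/-! ### Mixed moments of operators on a free product -/

section MomentFormula

variable {I J : Type*} {K : Type x} (X : K → StateSpace.{u})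
  (T : ∀ k, I ⊕ J → Module.End ℂ (X k).carrier)

/-- The moments of the operators on `X k`. -/
def spaceMoment (k : K) (w : List (I ⊕ J)) : ℂ :=
  (X k).ψ ((w.map (T k)).prod (X k).ξ)

theorem spaceMoment_nil (k : K) : spaceMoment X T k [] = 1 := (X k).ψ_ξ

variable [DecidableEq K]

/-- The centred vector `T_w ξ - ψ(T_w ξ) ξ`. -/
def centred (p : K × List (I ⊕ J)) : Tensors X :=
  letter X p.1 ((X p.1).proj₀ ((p.2.map (T p.1)).prod (X p.1).ξ))

theorem prod_attach_map {A B : Type*} [Ring B] [Algebra ℂ B] (f : A → B) (a : I ⊕ J) (p : A)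
    (l : List A) : ((attach a p l).map f).prod = faceMul a (f p) (l.map f).prod := by
  cases a <;> simp [attach, faceMul]

/-- The cases of `mixed` are the rules for `λ_k(T)` and `ρ_k(T)` on the empty tensor, on a leg of
colour `k` and on a leg of another colour. At the end a remaining centred leg has no vacuum
component. Alternation of the colours is not needed, as everything takes place in the full tensor
algebra. -/
theorem vacuumCoeff_prod_eq_mixed (ops : List (K × (I ⊕ J))) (st : List (K × List (I ⊕ J))) :
    vacuumCoeff X ((ops.reverse.map fun p => faceTensor X p.2 p.1 (T p.1 p.2)).prod
      (st.map (centred X T)).prod) = mixed (spaceMoment X T) ops st := by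
  have hincl : ∀ (k : K) (a : I ⊕ J) (w : List (I ⊕ J)),
      incl X k (T k a ((w.map (T k)).prod (X k).ξ)) =
        spaceMoment X T k (a :: w) • (1 : Tensors X) + centred X T (k, a :: w) := by
    intro k a w
    rw [incl_apply]
    simp [centred, spaceMoment]
  have hincl' : ∀ (k : K) (a : I ⊕ J),
      incl X k (T k a (X k).ξ) =
        spaceMoment X T k [a] • (1 : Tensors X) + centred X T (k, [a]) :=
    fun k a => hincl k a []
  have happ : ∀ (k : K) (a : I ⊕ J) (ops : List (K × (I ⊕ J))) (t : Tensors X),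
      ((((k, a) :: ops).reverse.map fun p => faceTensor X p.2 p.1 (T p.1 p.2)).prod :
        Module.End ℂ (Tensors X)) t =
      ((ops.reverse.map fun p => faceTensor X p.2 p.1 (T p.1 p.2)).prod :
        Module.End ℂ (Tensors X)) (faceTensor X a k (T k a) t) := by
    intro k a ops t
    simp
  refine mixed_induction ?_ ?_ ?_ ?_ ops st <;> clear st ops
  · intro st
    cases st with
    | nil => simp [mixed]
    | cons p st =>
      have : vacuumCoeff X (centred X T p) = 0 := vacuumCoeff_letter X _ _
      simp only [List.reverse_nil, List.map_nil, List.prod_nil, List.map_cons, List.prod_cons,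
        Module.End.one_apply, map_mul, this, zero_mul, mixed]
      simp
  · intro k a ops ih
    rw [happ, mixed_cons_nil, ← ih, ← ih, prod_attach_map, List.map_nil, List.prod_nil,
      faceTensor_one, hincl', faceMul_one]
    simp
  · intro k a ops w t ih
    have h : (centred X T (k, w)) =
        letter X k ((X k).proj₀ ((w.map (T k)).prod (X k).ξ)) := rfl
    rw [happ, mixed_cons_same, ← ih, ← ih, ← ih, prod_attach_map, prod_attach_map,
      prod_attach_map, h, faceTensor_same, StateSpace.coe_proj₀, map_sub, map_sub, map_smul,
      map_smul, hincl, hincl']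
    simp only [map_add, map_smul, LinearMap.add_apply, LinearMap.sub_apply, LinearMap.smul_apply,
      map_sub, one_faceMul, smul_eq_mul, spaceMoment]
  · intro k a ops j w t hjk ih
    have h : (centred X T (j, w)) =
        letter X j ((X j).proj₀ ((w.map (T j)).prod (X j).ξ)) := rfl
    rw [happ, mixed_cons_ne _ hjk, ← ih, ← ih, prod_attach_map, prod_attach_map, h,
      faceTensor_ne X hjk, hincl', ← h, prod_attach_map]
    simp only [map_add, map_smul, LinearMap.add_apply, LinearMap.smul_apply,
      one_faceMul, smul_eq_mul]

theorem vacuumCoeff_prod_one_eq_mixed (l : List (K × (I ⊕ J))) :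
    vacuumCoeff X ((l.map fun p => faceTensor X p.2 p.1 (T p.1 p.2)).prod 1) =
      mixed (spaceMoment X T) l.reverse [] := by
  simpa using vacuumCoeff_prod_eq_mixed X T l.reverse []

theorem vacuumState_prod (l : List (K × (I ⊕ J))) :
    vacuumState X (l.map fun p => faceOp X p.2 p.1 (T p.1 p.2)).prod =
      mixed (spaceMoment X T) l.reverse [] := by
  rw [vacuumState_apply, coe_prod_apply X _ _ fun p t => coe_faceOp X p.2 p.1 (T p.1 p.2) t]
  exact vacuumCoeff_prod_one_eq_mixed X T l

end MomentFormula

/-! ### Intertwining the operators on a free product -/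

section Intertwining

variable {I J : Type*} {K : Type x} [DecidableEq K] (Y : K → StateSpace.{u})
  {B : Type*} [Ring B] [Algebra ℂ B]

/-- The homomorphism from tensors to an algebra given by linear maps on the legs. -/
def liftLegs (f : ∀ k, (Y k).carrier →ₗ[ℂ] B) : Tensors Y →ₐ[ℂ] B :=
  TensorAlgebra.lift ℂ (DirectSum.toModule ℂ K B fun k => f k ∘ₗ (Y k).ker₀.subtype)

variable {Y} {f : ∀ k, (Y k).carrier →ₗ[ℂ] B}

theorem liftLegs_letter (k : K) (y : (Y k).ker₀) : liftLegs Y f (letter Y k y) = f k y := by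
  simp [liftLegs, letter]

theorem liftLegs_incl (hf : ∀ k, f k (Y k).ξ = 1) (k : K) (y : (Y k).carrier) :
    liftLegs Y f (incl Y k y) = f k y := by
  rw [incl_apply, map_add, liftLegs_letter, map_smul, map_one, StateSpace.coe_proj₀, map_sub,
    map_smul, hf]
  abel

/-- The three hypotheses mirror the three rules that define the operator. They are required only for
centred legs, since the tensor algebra is built from these. -/
theorem liftLegs_faceTensor (hf : ∀ k, f k (Y k).ξ = 1) (a : I ⊕ J) (k : K)
    (U : Module.End ℂ (Y k).carrier) (L : B →ₗ[ℂ] B) (h1 : L 1 = f k (U (Y k).ξ))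
    (h2 : ∀ y, (Y k).ψ y = 0 → ∀ b, L (faceMul a (f k y) b) = faceMul a (f k (U y)) b)
    (h3 : ∀ j, j ≠ k → ∀ y, (Y j).ψ y = 0 → ∀ b,
      L (faceMul a (f j y) b) = faceMul a (f k (U (Y k).ξ)) (faceMul a (f j y) b))
    (t : Tensors Y) :
    liftLegs Y f (faceTensor Y a k U t) = L (liftLegs Y f t) := by
  have : (liftLegs Y f).toLinearMap ∘ₗ faceTensor Y a k U =
      L ∘ₗ (liftLegs Y f).toLinearMap := by
    refine tensors_ext Y a ?_ fun j y t => ?_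
    · simp [faceTensor_one, liftLegs_incl hf, h1]
    · have hL : (liftLegs Y f) (faceMul a (letter Y j y) t) = faceMul a (f j y) (liftLegs Y f t) := by
        rw [map_faceMul, liftLegs_letter]
      simp only [LinearMap.comp_apply, AlgHom.toLinearMap_apply, hL]
      by_cases h : j = k
      · subst h
        rw [h2 y y.2, faceTensor_same, map_faceMul, liftLegs_incl hf]
      · rw [h3 j h y y.2, faceTensor_ne Y h, map_faceMul, liftLegs_incl hf, hL]
  exact LinearMap.congr_fun this t

theorem vacuumCoeff_eq_of_liftLegs (χ : B →ₐ[ℂ] ℂ)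
    (hχ : ∀ k y, χ (f k y) = (Y k).ψ y) (t : Tensors Y) :
    χ (liftLegs Y f t) = vacuumCoeff Y t := by
  have : χ.comp (liftLegs Y f) = vacuumCoeff Y := by
    refine TensorAlgebra.hom_ext (DirectSum.linearMap_ext ℂ fun k => LinearMap.ext fun y => ?_)
    have h1 := vacuumCoeff_letter Y k y
    have h2 := liftLegs_letter (f := f) k y
    simp only [letter] at h1 h2
    simp only [LinearMap.comp_apply, AlgHom.toLinearMap_apply, AlgHom.comp_apply, h1, h2, hχ]
    exact y.2
  exact AlgHom.congr_fun this t

theorem prod_intertwine {A M N : Type*} [AddCommGroup M] [Module ℂ M] [AddCommGroup N]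
    [Module ℂ N] (Φ : M →ₗ[ℂ] N) (op : A → Module.End ℂ M) (op' : A → Module.End ℂ N)
    (h : ∀ p t, Φ (op p t) = op' p (Φ t)) (l : List A) (t : M) :
    Φ ((l.map op).prod t) = (l.map op').prod (Φ t) := by
  induction l with
  | nil => rfl
  | cons p l ih => simp [h, ih]

end Intertwining

/-! ### Associativity of the bi-free product -/

section Associativity

variable {I J : Type*} {K : Type w} [DecidableEq K] {K' : Type x} [DecidableEq K']
  (X : K' → StateSpace.{u})

variable (K) in
/-- A family of copies, indexed by `K`, of the family `X`. -/
abbrev copies : K × K' → StateSpace.{u} := fun p => X p.2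

/-- The inclusion of the tensors over the `k`-th copy of the family `X`. -/
def copyHom (k : K) : Tensors X →ₐ[ℂ] Tensors (copies K X) :=
  liftLegs X fun i => incl (copies K X) (k, i)

theorem copyHom_letter (k : K) (i : K') (y : (X i).ker₀) :
    copyHom X k (letter X i y) = letter (copies K X) (k, i) y := by
  rw [copyHom, liftLegs_letter]
  exact incl_of_ψ_eq_zero (copies K X) (k := (k, i)) y.2

theorem copyHom_incl (k : K) (i : K') (y : (X i).carrier) :
    copyHom X k (incl X i y) = incl (copies K X) (k, i) y :=
  liftLegs_incl (fun i => incl_ξ (copies K X) (k, i)) i y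

/-- Since `t` has no vacuum component, the leg met by the operator belongs to `t` and not to `b`,
and its colour `(k, j)` agrees with `(k, i)` exactly if `j = i`. -/
theorem faceTensor_copyHom_same (a : I ⊕ J) (k : K) (i : K') (T : Module.End ℂ (X i).carrier)
    (t : Tensors X) (ht : vacuumCoeff X t = 0) (b : Tensors (copies K X)) :
    faceTensor (copies K X) a (k, i) T (faceMul a (copyHom X k t) b) =
      faceMul a (copyHom X k (faceTensor X a i T t)) b := by
  -- Composing with the projection `c` onto tensors without vacuum component turns the claim into an
  -- identity of linear maps, which can be tested on `1` and on tensors with a leg on the face of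
  -- `a`.
  let c : Tensors X →ₗ[ℂ] Tensors X :=
    LinearMap.id - (vacuumCoeff X).toLinearMap.smulRight 1
  have hc : ∀ s, c s = s - vacuumCoeff X s • 1 := fun s => rfl
  have : faceTensor (copies K X) a (k, i) T ∘ₗ (faceMul a).flip b ∘ₗ
      (copyHom X k).toLinearMap ∘ₗ c =
      (faceMul a).flip b ∘ₗ (copyHom X k).toLinearMap ∘ₗ faceTensor X a i T ∘ₗ c := by
    refine tensors_ext X a (by simp [hc]) fun j y s => ?_
    simp only [LinearMap.comp_apply, hc, vacuumCoeff_faceMul_letter, zero_smul, sub_zero,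
      LinearMap.flip_apply, AlgHom.toLinearMap_apply]
    by_cases h : j = i
    · subst h
      rw [faceTensor_same, map_faceMul, map_faceMul, faceMul_assoc, faceMul_assoc,
        copyHom_letter, copyHom_incl]
      exact faceTensor_same (copies K X) a (k, j) T y _
    · rw [faceTensor_ne X h, map_faceMul, map_faceMul, map_faceMul, faceMul_assoc, faceMul_assoc,
        faceMul_assoc, copyHom_letter, copyHom_incl]
      exact faceTensor_ne (copies K X) (j := (k, j)) (k := (k, i)) (by simpa using h) a T y _
  have h := LinearMap.congr_fun this t
  simpa [hc, ht] using h

/-- All legs of the `j`-th copy have colours `(j, l)`, different from `(k, i)`, so the operator only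
adds its own vector in front of them. -/
theorem faceTensor_copyHom_ne (a : I ⊕ J) {j k : K} (hjk : j ≠ k) (i : K')
    (T : Module.End ℂ (X i).carrier)
    (t : Tensors X) (ht : vacuumCoeff X t = 0) (b : Tensors (copies K X)) :
    faceTensor (copies K X) a (k, i) T (faceMul a (copyHom X j t) b) =
      faceMul a (incl (copies K X) (k, i) (T (X i).ξ)) (faceMul a (copyHom X j t) b) := by
  let c : Tensors X →ₗ[ℂ] Tensors X :=
    LinearMap.id - (vacuumCoeff X).toLinearMap.smulRight 1
  have hc : ∀ s, c s = s - vacuumCoeff X s • 1 := fun s => rfl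
  have : faceTensor (copies K X) a (k, i) T ∘ₗ (faceMul a).flip b ∘ₗ
      (copyHom X j).toLinearMap ∘ₗ c =
      faceMul a (incl (copies K X) (k, i) (T (X i).ξ)) ∘ₗ (faceMul a).flip b ∘ₗ
      (copyHom X j).toLinearMap ∘ₗ c := by
    refine tensors_ext X a (by simp [hc]) fun l y s => ?_
    simp only [LinearMap.comp_apply, hc, vacuumCoeff_faceMul_letter, zero_smul, sub_zero,
      LinearMap.flip_apply, AlgHom.toLinearMap_apply]
    rw [map_faceMul, faceMul_assoc, copyHom_letter]
    exact faceTensor_ne (copies K X) (j := (j, l)) (k := (k, i)) (by simp [hjk]) a T y _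
  have h := LinearMap.congr_fun this t
  simpa [hc, ht] using h

/-- Sums over `K'` of operators on the free product of the `X i`, lifted to copies of the free
product, have the same mixed moments as the sums over `K'` of operators on the free product of all
copies of all `X i`. -/
theorem vacuumCoeff_copies [Fintype K'] (T : ∀ i, I ⊕ J → Module.End ℂ (X i).carrier)
    (l : List (K × (I ⊕ J))) :
    vacuumCoeff (fun _ : K => freeProductSpace X)
      ((l.map fun p => faceTensor (fun _ : K => freeProductSpace X) p.2 p.1
        (∑ i, faceOp X p.2 i (T i p.2))).prod 1) =
    vacuumCoeff (copies K X)
      ((l.map fun p => ∑ i, faceTensor (copies K X) p.2 (p.1, i) (T i p.2)).prod 1) := by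
  -- A leg in the `k`-th copy of the free product is itself a tensor; `f` dissolves it into its own
  -- legs, coloured by pairs.
  let f : ∀ _ : K, (freeProductSpace X).carrier →ₗ[ℂ] Tensors (copies K X) :=
    fun k => (copyHom X k).toLinearMap ∘ₗ (FreeProduct X).subtype
  have hf : ∀ k, f k (freeProductSpace X).ξ = 1 := fun k => map_one (copyHom X k)
  have hχ : ∀ k y, vacuumCoeff (copies K X) (f k y) = (freeProductSpace X).ψ y := fun k y =>
    vacuumCoeff_eq_of_liftLegs (Y := X) (f := fun i => incl (copies K X) (k, i))
      (vacuumCoeff (copies K X))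
      (fun i y => vacuumCoeff_incl (copies K X) (k, i) y) (y : FreeProduct X).1
  have hsum : ∀ (k : K) (a : I ⊕ J) (y : FreeProduct X),
      f k ((∑ i, faceOp X a i (T i a)) y) =
        ∑ i, copyHom X k (faceTensor X a i (T i a) (y : Tensors X)) := by
    intro k a y
    change copyHom X k (((∑ i, faceOp X a i (T i a)) y : FreeProduct X) : Tensors X) = _
    simp [coe_faceOp]
  have hvac : ∀ (k : K) (a : I ⊕ J),
      f k ((∑ i, faceOp X a i (T i a)) (vacuum X)) =
        ∑ i, incl (copies K X) (k, i) (T i a (X i).ξ) := by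
    intro k a
    rw [hsum]
    refine Finset.sum_congr rfl fun i _ => ?_
    change copyHom X k (faceTensor X a i (T i a) 1) = _
    rw [faceTensor_one, copyHom_incl]
  rw [← vacuumCoeff_eq_of_liftLegs _ hχ]
  congr 1
  refine (prod_intertwine (liftLegs _ f).toLinearMap _
    (fun p : K × (I ⊕ J) => ∑ i, faceTensor (copies K X) p.2 (p.1, i) (T i p.2)) ?_ l 1).trans
    (by simp)
  rintro ⟨k, a⟩ t
  refine liftLegs_faceTensor hf a k _ _ ?_ ?_ ?_ t
  · refine Eq.trans ?_ (hvac k a).symm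
    simp [faceTensor_one]
  · intro y hy b
    refine Eq.trans ?_ (congrArg (fun z => faceMul a z b) (hsum k a y)).symm
    rw [LinearMap.sum_apply, map_sum, LinearMap.sum_apply]
    exact Finset.sum_congr rfl fun i _ => faceTensor_copyHom_same X a k i (T i a) _ hy b
  · intro j hj y hy b
    refine Eq.trans ?_ (congrArg (fun z => faceMul a z (faceMul a (f j y) b)) (hvac k a)).symm
    rw [LinearMap.sum_apply, map_sum, LinearMap.sum_apply]
    exact Finset.sum_congr rfl fun i _ => faceTensor_copyHom_ne X a hj i (T i a) _ hy b

end Associativity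

/-! ### Existence of the cumulant polynomials -/

section Colourings

variable {S : Type*} {K : Type*}

theorem prod_ofFn_sum {B : Type*} [Semiring B] [Fintype K] {n : ℕ} (y : Fin n → K → B) :
    (List.ofFn fun j => ∑ k, y j k).prod =
      ∑ κ : Fin n → K, (List.ofFn fun j => y j (κ j)).prod := by
  induction n with
  | zero => simp
  | succ n ih =>
    rw [List.ofFn_succ, List.prod_cons, ih, ← (Fin.consEquiv fun _ => K).sum_comp,
      Fintype.sum_prod_type, Finset.sum_mul_sum]
    simp [Fin.consEquiv, List.ofFn_succ]

/-- The word `s`, its letters being coloured by `κ`. -/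
def paint (s : List S) (κ : Fin s.length → K) : List (K × S) :=
  List.ofFn fun j => (κ j, s.get j)

theorem paint_map_snd (s : List S) (κ : Fin s.length → K) : (paint s κ).map Prod.snd = s := by
  simp [paint, List.map_ofFn, Function.comp_def]

theorem paint_length (s : List S) (κ : Fin s.length → K) : (paint s κ).length = s.length := by
  simp [paint]

theorem paint_const (s : List S) (k : K) : paint s (fun _ => k) = s.map (Prod.mk k) := by
  conv_rhs => rw [← List.ofFn_get s, List.map_ofFn]
  rfl

theorem mem_paint {s : List S} {κ : Fin s.length → K} {p : K × S} :
    p ∈ paint s κ ↔ ∃ j, (κ j, s.get j) = p := by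
  simp [paint, List.mem_ofFn]

theorem map_paint {K' : Type*} (f : K → K') (s : List S) (κ : Fin s.length → K) :
    (paint s κ).map (Prod.map f id) = paint s (f ∘ κ) := by
  simp [paint, List.map_ofFn, Function.comp_def]

theorem prod_map_sum {B : Type*} [Semiring B] [Fintype K] (s : List S) (y : K → S → B) :
    (s.map fun a => ∑ k, y k a).prod =
      ∑ κ : Fin s.length → K, ((paint s κ).map fun p => y p.1 p.2).prod := by
  conv_lhs => rw [← List.ofFn_get s, List.map_ofFn]
  simp only [paint, List.map_ofFn]
  exact prod_ofFn_sum fun j k => y k (s.get j)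

theorem prod_map_paint_sum {K' B : Type*} [Semiring B] [Fintype K'] (s : List S)
    (κ : Fin s.length → K) (y : K × K' → S → B) :
    ((paint s κ).map fun p => ∑ i, y (p.1, i) p.2).prod =
      ∑ ε : Fin s.length → K',
        ((paint s fun j => (κ j, ε j)).map fun p => y p.1 p.2).prod := by
  simp only [paint, List.map_ofFn]
  exact prod_ofFn_sum fun j i => y (κ j, i) (s.get j)

end Colourings

/-! ### Cumulants from roots of unity -/

section CumulantPolynomial

open MvPolynomial

variable {I J : Type*}

/-- The sum of the mixed moments of `n` bi-free copies of a family with moments `m`, over all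
colourings of the word `s` of length `n`, weighted by `n`-th roots of unity. -/
def rootSum {R : Type*} [CommRing R] [Algebra ℂ R] (s : List (I ⊕ J)) [NeZero s.length]
    (m : List (I ⊕ J) → R) : R :=
  ∑ κ : Fin s.length → ZMod s.length, algebraMap ℂ R (∏ j, ZMod.stdAddChar (κ j)) *
    mixed (fun _ => m) (paint s κ).reverse []

/-- The bi-free cumulant polynomial, `1 / n` times the moment of the word `s` in the sum
`ω z⁽¹⁾ + ⋯ + ωⁿ z⁽ⁿ⁾` of bi-free copies, `ω` being a primitive `n`-th root of unity. -/
def cumulantPoly (s : List (I ⊕ J)) [NeZero s.length] : MvPolynomial (List (I ⊕ J)) ℂ :=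
  C (s.length : ℂ)⁻¹ * rootSum s wordVar

theorem eval_cumulantPoly (s : List (I ⊕ J)) [NeZero s.length] {m : List (I ⊕ J) → ℂ}
    (hm : m [] = 1) : eval m (cumulantPoly s) = (s.length : ℂ)⁻¹ * rootSum s m := by
  have h : (fun (_ : ZMod s.length) w => eval m (wordVar w)) = fun _ => m := by
    funext _ w
    exact eval_wordVar hm w
  simp only [cumulantPoly, rootSum, map_mul, map_sum, eval_C, MvPolynomial.algebraMap_eq,
    map_mixed, h]
  rfl

theorem cumulantPoly_isWeightedHomogeneous (s : List (I ⊕ J)) [NeZero s.length] :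
    IsWeightedHomogeneous (fun t : List (I ⊕ J) => t.length) (cumulantPoly s) s.length := by
  refine IsWeightedHomogeneous.C_mul (IsWeightedHomogeneous.sum _ _ _ fun κ _ => ?_) _
  refine IsWeightedHomogeneous.C_mul ?_ _
  simpa [paint_length] using mixed_wordVar_isWeightedHomogeneous (paint s κ).reverse []

theorem mixed_paint_const {K R : Type*} [DecidableEq K] [CommRing R] (s : List (I ⊕ J)) (k : K)
    (m : K → List (I ⊕ J) → R) (hm : m k [] = 1) :
    mixed m (s.map (Prod.mk k)).reverse [] = m k s := by
  rw [← List.map_reverse, (mixed_replicate m k hm s.reverse).1, List.reverse_reverse]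

/-- The sum of indicators is `1` for a constant colouring and `0` otherwise. A one-coloured subword
equal to the whole word would force the colouring to be constant. -/
theorem mixed_paint_sub_mem_supported {K : Type*} [DecidableEq K] [Fintype K] (s : List (I ⊕ J))
    (hs : s ≠ []) (κ : Fin s.length → K) :
    mixed (fun _ w => wordVar w) (paint s κ).reverse [] -
      C (∑ k, if κ = (fun _ => k) then 1 else 0) * X s ∈
      supported ℂ {t : List (I ⊕ J) | t ≠ [] ∧ t.Sublist s ∧ t ≠ s} := by
  have : Nonempty (Fin s.length) := ⟨⟨0, List.length_pos_iff.2 hs⟩⟩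
  by_cases h : ∃ k, κ = fun _ => k
  · obtain ⟨k, rfl⟩ := h
    have h1 : (∑ l, if (fun _ : Fin s.length => k) = (fun _ => l) then (1 : ℂ) else 0) = 1 := by
      rw [Finset.sum_eq_single k]
      · simp
      · intro l _ hl
        rw [if_neg]
        intro h
        exact hl (congrFun h (Classical.arbitrary _)).symm
      · simp
    rw [h1, paint_const, mixed_paint_const s k _ (by simp [wordVar])]
    simp [wordVar, hs]
  · have h1 : (∑ l, if κ = (fun _ => l) then (1 : ℂ) else 0) = 0 :=
      Finset.sum_eq_zero fun l _ => if_neg fun hl => h ⟨l, hl⟩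
    rw [h1, map_zero, zero_mul, sub_zero]
    have h2 := mixed_wordVar_mem_supported (paint s κ).reverse [] [] (by simp)
    refine supported_mono ?_ h2
    rintro t ⟨ht, k, htk⟩
    rw [List.reverse_reverse, List.append_nil] at htk
    have h3 := restrict_sublist k (paint s κ)
    rw [paint_map_snd] at h3
    refine ⟨ht, htk.trans h3, ?_⟩
    rintro rfl
    refine h ⟨k, funext fun j => ?_⟩
    have h4 : (restrict k (paint t κ)).length = (paint t κ).length :=
      le_antisymm (by simpa [paint_length] using h3.length_le)
        (by simpa [paint_length] using htk.length_le)
    exact (restrict_length k _).1 h4 _ (mem_paint.2 ⟨j, rfl⟩)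

/-- Each of the `n` constant colourings carries the weight `(ω^k)^n = 1`. Together they contribute
`n X_s`, which the factor `1 / n` normalizes. -/
theorem cumulantPoly_sub_mem_supported (s : List (I ⊕ J)) [NeZero s.length] :
    cumulantPoly s - X s ∈
      supported ℂ {t : List (I ⊕ J) | t ≠ [] ∧ t.Sublist s ∧ t ≠ s} := by
  have hs : s ≠ [] := List.length_pos_iff.1 (Nat.pos_of_ne_zero (NeZero.ne _))
  have hn : (s.length : ℂ) ≠ 0 := Nat.cast_ne_zero.2 (NeZero.ne _)
  have hroot : ∑ κ : Fin s.length → ZMod s.length, (∏ j, ZMod.stdAddChar (κ j)) *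
      (∑ k, if κ = (fun _ => k) then (1 : ℂ) else 0) = s.length := by
    simp_rw [Finset.mul_sum]
    rw [Finset.sum_comm]
    have : ∀ k : ZMod s.length, (ZMod.stdAddChar k : ℂ) ^ s.length = 1 := by
      intro k
      rw [← AddChar.map_nsmul_eq_pow]
      simp
    simp [this]
  have hX : (X s : MvPolynomial (List (I ⊕ J)) ℂ) = C (s.length : ℂ)⁻¹ *
      ∑ κ : Fin s.length → ZMod s.length, C (∏ j, ZMod.stdAddChar (κ j)) *
      (C (∑ k, if κ = (fun _ => k) then (1 : ℂ) else 0) * X s) := by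
    simp_rw [← mul_assoc, ← C_mul]
    rw [← Finset.sum_mul, ← map_sum, hroot, ← mul_assoc, ← C_mul, inv_mul_cancel₀ hn, C_1, one_mul]
  have : cumulantPoly s - X s = C (s.length : ℂ)⁻¹ *
      ∑ κ : Fin s.length → ZMod s.length, C (∏ j, ZMod.stdAddChar (κ j)) *
      (mixed (fun _ w => wordVar w) (paint s κ).reverse [] -
        C (∑ k, if κ = (fun _ => k) then (1 : ℂ) else 0) * X s) := by
    conv_lhs => rw [hX]
    rw [cumulantPoly, ← mul_sub, rootSum, ← Finset.sum_sub_distrib]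
    simp_rw [mul_sub]
    rfl
  rw [this]
  exact mul_mem (Subalgebra.algebraMap_mem _ _) (sum_mem fun κ _ =>
    mul_mem (Subalgebra.algebraMap_mem _ _) (mixed_paint_sub_mem_supported s hs κ))

/-- Mixed terms vanish: shifting the copies of the first of two families is a symmetry that
multiplies the sum by a root of unity different from `1`. -/
theorem rootSum_mixed_eq_zero (s : List (I ⊕ J)) [NeZero s.length] (m : Fin 2 → List (I ⊕ J) → ℂ)
    (ε : Fin s.length → Fin 2) (h0 : ε ≠ fun _ => 0) (h1 : ε ≠ fun _ => 1) :
    ∑ κ : Fin s.length → ZMod s.length, (∏ j, (ZMod.stdAddChar (κ j) : ℂ)) *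
      mixed (fun p : ZMod s.length × Fin 2 => m p.2)
        (paint s fun j => (κ j, ε j)).reverse [] = 0 := by
  let F : (Fin s.length → ZMod s.length) → ℂ := fun κ => (∏ j, (ZMod.stdAddChar (κ j) : ℂ)) *
    mixed (fun p : ZMod s.length × Fin 2 => m p.2) (paint s fun j => (κ j, ε j)).reverse []
  -- The translation by `δ` moves only the letters of the first family, of which there are `c`. As
  -- `ε` is not constant, `0 < c < n`.
  let δ : Fin s.length → ZMod s.length := fun j => if ε j = 0 then 1 else 0
  let c := (Finset.univ.filter fun j => ε j = 0).card
  have hδ : ∑ j, δ j = (c : ZMod s.length) := by simp [δ, c]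
  have hc0 : 0 < c := by
    rw [Finset.card_pos]
    by_contra h
    refine h1 (_root_.funext fun j => ?_)
    have : ε j ≠ 0 := fun hj => h ⟨j, by simpa using hj⟩
    exact Fin.eq_one_of_ne_zero _ this
  have hcn : c < s.length := by
    have : c < Finset.card (Finset.univ : Finset (Fin s.length)) := by
      refine Finset.card_lt_card (Finset.filter_ssubset.2 ?_)
      by_contra! h
      exact h0 (_root_.funext fun j => h j (Finset.mem_univ j))
    simpa using this
  have hω : (ZMod.stdAddChar (c : ZMod s.length) : ℂ) ≠ 1 := by
    intro h
    have h2 : (c : ZMod s.length) = 0 :=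
      ZMod.injective_stdAddChar (h.trans (AddChar.map_zero_eq_one ZMod.stdAddChar).symm)
    rw [ZMod.natCast_eq_zero_iff] at h2
    exact absurd (Nat.le_of_dvd hc0 h2) (not_le.2 hcn)
  -- The same translation as an injective relabelling of colours, under which mixed moments are
  -- invariant.
  let σ : ZMod s.length × Fin 2 → ZMod s.length × Fin 2 := fun p => (if p.2 = 0 then p.1 + 1 else p.1, p.2)
  have hσ : Function.Injective σ := by
    rintro ⟨k, i⟩ ⟨l, j⟩ h
    simp only [σ, Prod.mk.injEq] at h
    obtain ⟨h, rfl⟩ := h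
    split_ifs at h <;> simp_all
  have hchar : ∀ (δ : Fin s.length → ZMod s.length),
      (ZMod.stdAddChar (∑ j, δ j) : ℂ) = ∏ j, ZMod.stdAddChar (δ j) := fun δ =>
    map_prod (ZMod.stdAddChar : AddChar (ZMod s.length) ℂ).toMonoidHom
      (fun j => Multiplicative.ofAdd (δ j)) Finset.univ
  have hshift : ∀ κ, F (κ + δ) = ZMod.stdAddChar (c : ZMod s.length) * F κ := by
    intro κ
    have hmix : mixed (fun p : ZMod s.length × Fin 2 => m p.2)
        (paint s fun j => ((κ + δ) j, ε j)).reverse [] =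
        mixed (fun p : ZMod s.length × Fin 2 => m p.2) (paint s fun j => (κ j, ε j)).reverse [] := by
      have := mixed_map_colour hσ (fun p : ZMod s.length × Fin 2 => m p.2)
        (paint s fun j => (κ j, ε j)).reverse []
      rw [List.map_reverse, map_paint, List.map_nil] at this
      refine Eq.trans ?_ this
      congr 3
      funext j
      simp only [Function.comp_apply, σ, Pi.add_apply, δ]
      split_ifs <;> simp
    simp only [F, hmix]
    rw [← hδ, hchar, ← mul_assoc, ← Finset.prod_mul_distrib]
    congr 1
    refine Finset.prod_congr rfl fun j _ => ?_
    rw [Pi.add_apply, AddChar.map_add_eq_mul, mul_comm]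
  have hsum : ∑ κ, F κ = ZMod.stdAddChar (c : ZMod s.length) * ∑ κ, F κ := by
    rw [Finset.mul_sum, ← Equiv.sum_comp (Equiv.addRight δ) F]
    exact Finset.sum_congr rfl fun κ _ => hshift κ
  have : (ZMod.stdAddChar (c : ZMod s.length) - 1) * ∑ κ, F κ = 0 := by
    rw [sub_mul, ← hsum, one_mul, sub_self]
  exact (mul_eq_zero.1 this).resolve_left (sub_ne_zero.2 hω)

/-- The moments of a sum of two bi-free families. -/
def sumMoment (m : Fin 2 → List (I ⊕ J) → ℂ) (s : List (I ⊕ J)) : ℂ :=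
  ∑ ε : Fin s.length → Fin 2, mixed m (paint s ε).reverse []

theorem vacuumState_sum_prod (X : Fin 2 → StateSpace.{u})
    (T : ∀ k, I ⊕ J → Module.End ℂ (X k).carrier) (s : List (I ⊕ J)) :
    vacuumState X (s.map fun a => ∑ i, faceOp X a i (T i a)).prod =
      sumMoment (spaceMoment X T) s := by
  rw [prod_map_sum s fun i a => faceOp X a i (T i a), map_sum]
  exact Finset.sum_congr rfl fun ε _ => vacuumState_prod X T _

/-- Copies of a sum of two bi-free families are sums of copies, all bi-free. The moments of the sum
are realized on the free product space, and associativity identifies the iterated free product with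
that of all copies. -/
theorem mixed_sumMoment {K : Type*} [DecidableEq K] (X : Fin 2 → StateSpace.{u})
    (T : ∀ k, I ⊕ J → Module.End ℂ (X k).carrier) (s : List (I ⊕ J)) (κ : Fin s.length → K) :
    mixed (fun _ => sumMoment (spaceMoment X T)) (paint s κ).reverse [] =
      ∑ ε : Fin s.length → Fin 2, mixed (fun p : K × Fin 2 => spaceMoment X T p.2)
        (paint s fun j => (κ j, ε j)).reverse [] := by
  have hm : (fun _ : K => sumMoment (spaceMoment X T)) =
      spaceMoment (fun _ : K => freeProductSpace X)
        (fun _ a => ∑ i, faceOp X a i (T i a)) := by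
    funext k w
    exact (vacuumState_sum_prod X T w).symm
  rw [hm, ← vacuumCoeff_prod_one_eq_mixed]
  refine (vacuumCoeff_copies X T (paint s κ)).trans ?_
  rw [prod_map_paint_sum s κ fun p a => faceTensor (copies K X) a p (T p.2 a),
    LinearMap.sum_apply, map_sum]
  exact Finset.sum_congr rfl fun ε _ =>
    vacuumCoeff_prod_one_eq_mixed (copies K X) (fun p => T p.2) _

theorem rootSum_sumMoment (X : Fin 2 → StateSpace.{u})
    (T : ∀ k, I ⊕ J → Module.End ℂ (X k).carrier) (s : List (I ⊕ J)) [NeZero s.length] :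
    rootSum s (sumMoment (spaceMoment X T)) =
      rootSum s (spaceMoment X T 0) + rootSum s (spaceMoment X T 1) := by
  have : Nonempty (Fin s.length) := ⟨⟨0, Nat.pos_of_ne_zero (NeZero.ne _)⟩⟩
  have hconst : ∀ i : Fin 2, ∑ κ : Fin s.length → ZMod s.length,
      (∏ j, (ZMod.stdAddChar (κ j) : ℂ)) *
        mixed (fun p : ZMod s.length × Fin 2 => spaceMoment X T p.2)
          (paint s fun j => (κ j, i)).reverse [] = rootSum s (spaceMoment X T i) := by
    intro i
    refine Finset.sum_congr rfl fun κ _ => ?_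
    have := mixed_map_colour (Prod.mk_left_injective i)
      (fun p : ZMod s.length × Fin 2 => spaceMoment X T p.2) (paint s κ).reverse []
    rw [List.map_reverse, map_paint] at this
    exact congrArg _ this
  rw [rootSum]
  simp_rw [mixed_sumMoment, Finset.mul_sum]
  -- Only the two constant choices of a family survive. They are distinct because the word is
  -- non-empty.
  rw [Finset.sum_comm, Finset.sum_eq_add (fun _ => 0) (fun _ => 1)]
  · exact congrArg₂ _ (hconst 0) (hconst 1)
  · intro h
    exact absurd (congrFun h (Classical.arbitrary _)) (by simp)
  · intro ε _ h
    exact rootSum_mixed_eq_zero s _ ε h.1 h.2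
  · simp
  · simp

end CumulantPolynomial

/-! ### Moments of bi-free pairs and additivity of cumulants -/

section Cumulants

open MvPolynomial

theorem moment_distribution {S A : Type*} [Ring A] [Algebra ℂ A] (φ : A →ₗ[ℂ] ℂ) (z : S → A)
    (s : List S) : moment (distribution φ z) s = φ (s.map z).prod := by
  simp [moment, distribution, map_list_prod, Function.comp_def]

theorem faceOp_inl {I J : Type*} {K : Type x} [DecidableEq K] (X : K → StateSpace.{u}) (i : I) (k : K)
    (T : Module.End ℂ (X k).carrier) : faceOp X (Sum.inl i : I ⊕ J) k T = leftOp X k T := by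
  simp only [faceOp, Sum.elim_inl]

theorem faceOp_inr {I J : Type*} {K : Type x} [DecidableEq K] (X : K → StateSpace.{u}) (j : J) (k : K)
    (T : Module.End ℂ (X k).carrier) : faceOp X (Sum.inr j : I ⊕ J) k T = rightOp X k T := by
  simp only [faceOp, Sum.elim_inr]

variable {I : Type u} {J : Type v}

theorem bifree_family_eq {K : Type x} [DecidableEq K] (X : K → StateSpace.{w})
    (T : ∀ k, I ⊕ J → Module.End ℂ (X k).carrier) :
    (fun p : K × (I ⊕ J) => Sum.elim (fun i => leftOp X p.1 (T p.1 (Sum.inl i)))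
      (fun j => rightOp X p.1 (T p.1 (Sum.inr j))) p.2) =
    fun p => faceOp X p.2 p.1 (T p.1 p.2) := by
  funext p
  rcases p with ⟨k, a | a⟩
  · simp only [faceOp_inl, Sum.elim_inl]
  · simp only [faceOp_inr, Sum.elim_inr]


/-- The joint moments of a bi-free family in terms of operators on a free product. -/
theorem IsBifree.exists_mixed {K : Type x} [DecidableEq K] {A : Type*} [Ring A] [Algebra ℂ A]
    {φ : A →ₗ[ℂ] ℂ} {z : K → I ⊕ J → A} (h : IsBifree φ z) :
    ∃ (X : K → StateSpace.{max u v}) (T : ∀ k, I ⊕ J → Module.End ℂ (X k).carrier),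
      ∀ l : List (K × (I ⊕ J)), φ (l.map fun p => z p.1 p.2).prod =
        mixed (spaceMoment X T) l.reverse [] := by
  obtain ⟨X, T, h⟩ := h
  refine ⟨X, T, fun l => ?_⟩
  rw [bifree_family_eq] at h
  have h2 := congrArg (fun γ => moment γ l) h
  simp only [moment_distribution] at h2
  rw [h2, vacuumState_prod]

/-- The moments of a bi-free pair and of its sum in terms of operators on a free product. -/
theorem IsBifree.exists_spaceMoment {A : Type*} [Ring A] [Algebra ℂ A] {φ : A →ₗ[ℂ] ℂ}
    {z' z'' : I ⊕ J → A} (h : IsBifree φ ![z', z'']) :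
    ∃ (X : Fin 2 → StateSpace.{max u v}) (T : ∀ k, I ⊕ J → Module.End ℂ (X k).carrier),
      moment (distribution φ z') = spaceMoment X T 0 ∧
      moment (distribution φ z'') = spaceMoment X T 1 ∧
      moment (distribution φ (z' + z'')) = sumMoment (spaceMoment X T) := by
  obtain ⟨X, T, key⟩ := h.exists_mixed
  have hone : ∀ (k : Fin 2) (s : List (I ⊕ J)),
      φ (s.map (![z', z''] k)).prod = spaceMoment X T k s := by
    intro k s
    have := key (s.map (Prod.mk k))
    rwa [mixed_paint_const s k _ (spaceMoment_nil X T k), List.map_map] at this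
  refine ⟨X, T, _root_.funext fun s => ?_, _root_.funext fun s => ?_, _root_.funext fun s => ?_⟩
  · rw [moment_distribution]
    exact hone 0 s
  · rw [moment_distribution]
    exact hone 1 s
  · have hsum : z' + z'' = fun a => ∑ i, ![z', z''] i a := by
      funext a
      simp
    rw [moment_distribution, hsum, prod_map_sum s fun i a => ![z', z''] i a, map_sum]
    exact Finset.sum_congr rfl fun ε _ => key _

/-- Existence of the bi-free cumulant polynomials. -/
theorem isCumulantPolynomial_cumulantPoly (s : List (I ⊕ J)) [NeZero s.length] :
    IsCumulantPolynomial s (cumulantPoly s) := by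
  refine ⟨⟨cumulantPoly s - X s, by ring, fun t ht => ?_⟩, cumulantPoly_isWeightedHomogeneous s,
    fun A _ _ φ z' z'' hφ h => ?_⟩
  · exact mem_supported.1 (cumulantPoly_sub_mem_supported s) ht
  · have h1 : ∀ z : I ⊕ J → A, moment (distribution φ z) [] = 1 := fun z => by
      rw [moment_distribution]
      exact hφ
    rw [eval_cumulantPoly s (h1 z'), eval_cumulantPoly s (h1 z''), eval_cumulantPoly s (h1 _)]
    obtain ⟨Y, T, e1, e2, e3⟩ := h.exists_spaceMoment
    rw [e1, e2, e3, rootSum_sumMoment, mul_add]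

end Cumulants

/-! ### The algebraic full Fock space -/

section Words

variable (S : Type w)

/-- The space with basis the words in `S`, an algebra under concatenation. -/
abbrev Words : Type w := MonoidAlgebra ℂ (FreeMonoid S)

variable {S}

/-- The basis vector of the word `l`. -/
def basisWord (l : List S) : Words S := MonoidAlgebra.of ℂ _ (FreeMonoid.ofList l)

theorem basisWord_nil : basisWord ([] : List S) = 1 :=
  map_one (MonoidAlgebra.of ℂ (FreeMonoid S))

theorem basisWord_append (l l' : List S) :
    basisWord (l ++ l') = basisWord l * basisWord l' := by
  rw [basisWord, FreeMonoid.ofList_append, map_mul]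
  rfl

theorem basisWord_attach {I J : Type*} (a : I ⊕ J) (b : S) (l : List S) :
    basisWord (attach a b l) = faceMul a (basisWord [b]) (basisWord l) := by
  cases a
  · simp [attach, faceMul, ← basisWord_append]
  · simp [attach, faceMul, ← basisWord_append]

theorem words_ext_basis {M : Type*} [AddCommGroup M] [Module ℂ M] {f g : Words S →ₗ[ℂ] M}
    (h : ∀ l, f (basisWord l) = g (basisWord l)) : f = g := by
  refine MonoidAlgebra.lhom_ext' fun l => LinearMap.ext_ring ?_
  exact h l.toList

theorem words_ext {I J : Type*} {M : Type*} [AddCommGroup M] [Module ℂ M] (a : I ⊕ J)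
    {f g : Words S →ₗ[ℂ] M} (h1 : f 1 = g 1)
    (h2 : ∀ b t, f (faceMul a (basisWord [b]) t) = g (faceMul a (basisWord [b]) t)) : f = g := by
  refine words_ext_basis fun l => ?_
  rcases nil_or_attach a l with rfl | ⟨b, t, rfl⟩
  · rwa [basisWord_nil]
  · rw [basisWord_attach]
    exact h2 b _

/-- The homomorphism given by the images of the words of length one. -/
def wordsHom {B : Type*} [Ring B] [Algebra ℂ B] (f : S → B) : Words S →ₐ[ℂ] B :=
  MonoidAlgebra.lift ℂ B (FreeMonoid S) (FreeMonoid.lift f)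

theorem wordsHom_letter {B : Type*} [Ring B] [Algebra ℂ B] (f : S → B) (b : S) :
    wordsHom f (basisWord [b]) = f b := by
  rw [wordsHom, basisWord, MonoidAlgebra.lift_of]
  exact FreeMonoid.lift_eval_of f b

theorem wordsHom_letter_faceMul {I J : Type*} {B : Type*} [Ring B] [Algebra ℂ B] (f : S → B)
    (a : I ⊕ J) (b : S) (t : Words S) :
    wordsHom f (faceMul a (basisWord [b]) t) = faceMul a (f b) (wordsHom f t) := by
  rw [map_faceMul, wordsHom_letter]

variable (S) in
/-- The coefficient of the empty word. -/
def counit : Words S →ₐ[ℂ] ℂ := wordsHom fun _ => 0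

theorem counit_letter_faceMul {I J : Type*} (a : I ⊕ J) (b : S) (t : Words S) :
    counit S (faceMul a (basisWord [b]) t) = 0 := by
  rw [counit, wordsHom_letter_faceMul, map_zero, LinearMap.zero_apply]

/-- The sum of the creation operator of `b` and the annihilation operator of the functional `c`,
both acting from the side of the face of `a`. -/
def fockOp {I J : Type*} (a : I ⊕ J) (b : S) (c : S → ℂ) : Module.End ℂ (Words S) :=
  Finsupp.linearCombination ℂ (fun l : FreeMonoid S => basisWord (attach a b l.toList) +
    match detach a l.toList with
    | none => 0
    | some (d, t) => c d • basisWord t) ∘ₗ (MonoidAlgebra.coeffLinearEquiv ℂ).toLinearMap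

theorem fockOp_basisWord {I J : Type*} (a : I ⊕ J) (b : S) (c : S → ℂ) (l : List S) :
    fockOp a b c (basisWord l) = basisWord (attach a b l) +
      match detach a l with
      | none => 0
      | some (d, t) => c d • basisWord t := by
  have h : MonoidAlgebra.coeffLinearEquiv ℂ (basisWord l) =
      Finsupp.single (FreeMonoid.ofList l) (1 : ℂ) := rfl
  simp [fockOp, h]

theorem fockOp_one {I J : Type*} (a : I ⊕ J) (b : S) (c : S → ℂ) :
    fockOp a b c 1 = basisWord [b] := by
  rw [← basisWord_nil, fockOp_basisWord, detach_nil]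
  cases a <;> simp [attach]

theorem fockOp_letter_faceMul {I J : Type*} (a : I ⊕ J) (b : S) (c : S → ℂ) (d : S)
    (t : Words S) :
    fockOp a b c (faceMul a (basisWord [d]) t) =
      faceMul a (basisWord [b]) (faceMul a (basisWord [d]) t) + c d • t := by
  have : fockOp a b c ∘ₗ faceMul a (basisWord [d]) =
      faceMul a (basisWord [b]) ∘ₗ faceMul a (basisWord [d]) + c d • LinearMap.id := by
    refine words_ext_basis fun l => ?_
    simp only [LinearMap.comp_apply, LinearMap.add_apply, LinearMap.smul_apply, LinearMap.id_apply,
      ← basisWord_attach, fockOp_basisWord, detach_attach]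
  exact LinearMap.congr_fun this t

end Words

/-! ### Gaussian distributions and their stability under bi-free sums -/

section Gaussian

variable {I : Type u} {J : Type v} (C : I ⊕ J → I ⊕ J → ℂ)

/-- The distribution with covariance `C`, realized on the algebraic full Fock space. -/
def gaussian : FreeAlgebra ℂ (I ⊕ J) →ₗ[ℂ] ℂ :=
  distribution ((counit (I ⊕ J)).toLinearMap ∘ₗ LinearMap.applyₗ (1 : Words (I ⊕ J)))
    fun a => fockOp a a (C a)

theorem moment_gaussian (s : List (I ⊕ J)) :
    moment (gaussian C) s = counit _ ((s.map fun a => fockOp a a (C a)).prod 1) := by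
  rw [gaussian, moment_distribution]
  rfl

theorem gaussian_one : gaussian C 1 = 1 := by
  have := moment_gaussian C []
  simpa [moment] using this

theorem gaussian_ι_mul_ι (k l : I ⊕ J) :
    gaussian C (FreeAlgebra.ι ℂ k * FreeAlgebra.ι ℂ l) = C k l := by
  have := moment_gaussian C [k, l]
  simp only [moment, List.map_cons, List.map_nil, List.prod_cons, List.prod_nil, mul_one,
    Module.End.mul_apply, fockOp_one] at this
  rw [this, ← faceMul_one k (basisWord [l]), fockOp_letter_faceMul, map_add,
    counit_letter_faceMul]
  simp

variable (I J) in
/-- The algebraic full Fock space, as a space with specified state vector. -/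
def fockSpace : StateSpace.{max u v} where
  carrier := Words (I ⊕ J)
  ξ := 1
  ψ := (counit (I ⊕ J)).toLinearMap
  ψ_ξ := map_one (counit (I ⊕ J))

variable (I J) in
/-- The embedding of words that gives all letters the colour `k`. -/
def colourHom (k : Fin 2) : Words (I ⊕ J) →ₐ[ℂ] Words (Fin 2 × (I ⊕ J)) :=
  wordsHom fun b => basisWord [(k, b)]

/-- The covariance of a letter of colour `k` with the letters of both colours. -/
def colourCov (k : Fin 2) (a : I ⊕ J) (p : Fin 2 × (I ⊕ J)) : ℂ := if p.1 = k then C a p.2 else 0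

theorem counit_colourHom (k : Fin 2) (t : Words (I ⊕ J)) :
    counit _ (colourHom I J k t) = counit _ t := by
  have : ((counit _).comp (colourHom I J k)).toLinearMap = (counit (I ⊕ J)).toLinearMap := by
    refine words_ext_basis fun l => ?_
    cases l with
    | nil => simp [basisWord_nil]
    | cons b l =>
      have h := basisWord_append [b] l
      rw [List.singleton_append] at h
      simp [h, colourHom, counit, wordsHom_letter]
  exact LinearMap.congr_fun this t

/-- As `t` has no vacuum component, creation and annihilation act inside `t`, where all letters have
colour `k` and `colourCov` reduces to `C`. -/
theorem fockOp_colourHom_same (a : I ⊕ J) (k : Fin 2) (t : Words (I ⊕ J))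
    (ht : counit _ t = 0) (b : Words (Fin 2 × (I ⊕ J))) :
    fockOp a (k, a) (colourCov C k a) (faceMul a (colourHom I J k t) b) =
      faceMul a (colourHom I J k (fockOp a a (C a) t)) b := by
  let c : Words (I ⊕ J) →ₗ[ℂ] Words (I ⊕ J) :=
    LinearMap.id - (counit _).toLinearMap.smulRight 1
  have hc : ∀ s, c s = s - counit _ s • 1 := fun s => rfl
  have : fockOp a (k, a) (colourCov C k a) ∘ₗ (faceMul a).flip b ∘ₗ
      (colourHom I J k).toLinearMap ∘ₗ c =
      (faceMul a).flip b ∘ₗ (colourHom I J k).toLinearMap ∘ₗ fockOp a a (C a) ∘ₗ c := by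
    refine words_ext a (by simp [hc]) fun d s => ?_
    simp only [LinearMap.comp_apply, hc, counit_letter_faceMul, zero_smul, sub_zero,
      LinearMap.flip_apply, AlgHom.toLinearMap_apply]
    rw [fockOp_letter_faceMul, map_add, map_smul, colourHom, wordsHom_letter_faceMul,
      wordsHom_letter_faceMul, wordsHom_letter_faceMul, map_add, LinearMap.add_apply, map_smul,
      LinearMap.smul_apply, faceMul_assoc, faceMul_assoc, faceMul_assoc, fockOp_letter_faceMul]
    simp [colourCov]
  have h := LinearMap.congr_fun this t
  simpa [hc, ht] using h

/-- The annihilation part of colour `k` kills letters of colour `j`, so only creation remains, as a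
free product operator requires. -/
theorem fockOp_colourHom_ne (a : I ⊕ J) {j k : Fin 2} (hjk : j ≠ k) (t : Words (I ⊕ J))
    (ht : counit _ t = 0) (b : Words (Fin 2 × (I ⊕ J))) :
    fockOp a (k, a) (colourCov C k a) (faceMul a (colourHom I J j t) b) =
      faceMul a (basisWord [(k, a)]) (faceMul a (colourHom I J j t) b) := by
  let c : Words (I ⊕ J) →ₗ[ℂ] Words (I ⊕ J) :=
    LinearMap.id - (counit _).toLinearMap.smulRight 1
  have hc : ∀ s, c s = s - counit _ s • 1 := fun s => rfl
  have : fockOp a (k, a) (colourCov C k a) ∘ₗ (faceMul a).flip b ∘ₗ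
      (colourHom I J j).toLinearMap ∘ₗ c =
      faceMul a (basisWord [(k, a)]) ∘ₗ (faceMul a).flip b ∘ₗ
      (colourHom I J j).toLinearMap ∘ₗ c := by
    refine words_ext a (by simp [hc]) fun d s => ?_
    simp only [LinearMap.comp_apply, hc, counit_letter_faceMul, zero_smul, sub_zero,
      LinearMap.flip_apply, AlgHom.toLinearMap_apply]
    rw [colourHom, wordsHom_letter_faceMul, faceMul_assoc, fockOp_letter_faceMul]
    simp [colourCov, hjk]
  have h := LinearMap.congr_fun this t
  simpa [hc, ht] using h

/-- The free product of two full Fock spaces is a full Fock space. -/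
theorem vacuumCoeff_fockSpace (s : List (I ⊕ J)) :
    vacuumCoeff (fun _ : Fin 2 => fockSpace I J)
      ((s.map fun a => ∑ k, faceTensor (fun _ : Fin 2 => fockSpace I J) a k
        (fockOp a a (C a))).prod 1) =
    counit _ ((s.map fun a => ∑ k : Fin 2, fockOp a (k, a) (colourCov C k a)).prod 1) := by
  let f : ∀ _ : Fin 2, (fockSpace I J).carrier →ₗ[ℂ] Words (Fin 2 × (I ⊕ J)) :=
    fun k => (colourHom I J k).toLinearMap
  have hf : ∀ k, f k (fockSpace I J).ξ = 1 := fun k => map_one (colourHom I J k)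
  have hone : ∀ (k : Fin 2) (a : I ⊕ J),
      f k (fockOp a a (C a) (1 : Words (I ⊕ J))) = basisWord [(k, a)] := by
    intro k a
    rw [fockOp_one]
    exact wordsHom_letter _ a
  rw [← vacuumCoeff_eq_of_liftLegs (f := f) _ counit_colourHom]
  congr 1
  refine (prod_intertwine (liftLegs _ f).toLinearMap _
    (fun a : I ⊕ J => ∑ k : Fin 2, fockOp a (k, a) (colourCov C k a)) ?_ s 1).trans (by simp)
  intro a t
  rw [LinearMap.sum_apply, map_sum, LinearMap.sum_apply]
  refine Finset.sum_congr rfl fun k _ => ?_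
  refine liftLegs_faceTensor hf a k _ _ ?_ ?_ ?_ t
  · rw [fockOp_one]
    exact (hone k a).symm
  · intro y hy b
    exact fockOp_colourHom_same C a k y hy b
  · intro j hj y hy b
    refine Eq.trans ?_ (congrArg (fun z => faceMul a z (faceMul a (f j y) b)) (hone k a)).symm
    exact fockOp_colourHom_ne C a hj y hy b

/-- The embedding `b ↦ r⁻¹ • ∑ k, (k, b)` of the Fock space, with `r² = 2`, intertwines a
Gaussian family times `r` with the sum of two bi-free copies. -/
theorem counit_sum_fockOp {r : ℂ} (hr : r ^ 2 = 2) (s : List (I ⊕ J)) :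
    counit _ ((s.map fun a => ∑ k : Fin 2, fockOp a (k, a) (colourCov C k a)).prod 1) =
      r ^ s.length * moment (gaussian C) s := by
  have hr0 : r ≠ 0 := by
    rintro rfl
    norm_num at hr
  let g : I ⊕ J → Words (Fin 2 × (I ⊕ J)) := fun b => r⁻¹ • ∑ k : Fin 2, basisWord [(k, b)]
  have hg : ∀ b, r • g b = ∑ k : Fin 2, basisWord [(k, b)] := fun b => smul_inv_smul₀ hr0 _
  have hΨ : ∀ a t, (∑ k : Fin 2, fockOp a (k, a) (colourCov C k a)) (wordsHom g t) =
      r • wordsHom g (fockOp a a (C a) t) := by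
    intro a t
    have : (∑ k : Fin 2, fockOp a (k, a) (colourCov C k a)) ∘ₗ (wordsHom g).toLinearMap =
        r • (wordsHom g).toLinearMap ∘ₗ fockOp a a (C a) := by
      refine words_ext a ?_ fun b t => ?_
      · simp only [LinearMap.comp_apply, LinearMap.smul_apply, AlgHom.toLinearMap_apply, map_one,
          LinearMap.sum_apply, fockOp_one, wordsHom_letter, hg]
      · have h1 : ∀ k : Fin 2, fockOp a (k, a) (colourCov C k a) (faceMul a (g b) (wordsHom g t)) =
            faceMul a (basisWord [(k, a)]) (faceMul a (g b) (wordsHom g t)) +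
              (r⁻¹ * C a b) • wordsHom g t := by
          intro k
          simp only [g, map_smul, LinearMap.smul_apply, map_sum, LinearMap.sum_apply,
            fockOp_letter_faceMul, Finset.sum_add_distrib, smul_add, ← Finset.sum_smul, smul_smul]
          simp [colourCov]
        -- Both colours annihilate the diagonal letter `g b` with weight `r⁻¹ C a b`; since `2 r⁻¹ =
        -- r`, the total is `r` times the original weight.
        have h2 : r⁻¹ * C a b + r⁻¹ * C a b = r * C a b := by
          field_simp
          rw [hr]
          ring
        have h3 : ∑ k : Fin 2, faceMul a (basisWord [(k, a)]) (faceMul a (g b) (wordsHom g t)) =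
            r • faceMul a (g a) (faceMul a (g b) (wordsHom g t)) := by
          rw [← LinearMap.smul_apply, ← map_smul, hg, map_sum, LinearMap.sum_apply]
        simp only [LinearMap.comp_apply, LinearMap.smul_apply, AlgHom.toLinearMap_apply,
          LinearMap.sum_apply, fockOp_letter_faceMul, map_add, map_smul, wordsHom_letter_faceMul,
          h1, Finset.sum_add_distrib, h3, smul_add, smul_smul]
        rw [Fin.sum_univ_two, ← add_smul, h2]
    exact LinearMap.congr_fun this t
  have hprod : ∀ s : List (I ⊕ J),
      (s.map fun a => ∑ k : Fin 2, fockOp a (k, a) (colourCov C k a)).prod 1 =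
        r ^ s.length • wordsHom g ((s.map fun a => fockOp a a (C a)).prod 1) := by
    intro s
    induction s with
    | nil => simp
    | cons a s ih =>
      rw [List.map_cons, List.prod_cons, Module.End.mul_apply, ih, map_smul, hΨ, List.map_cons,
        List.prod_cons, Module.End.mul_apply, smul_smul, List.length_cons, pow_succ]
  have hχ : ∀ t, counit _ (wordsHom g t) = counit _ t := by
    intro t
    have : ((counit _).comp (wordsHom g)).toLinearMap = (counit (I ⊕ J)).toLinearMap := by
      refine words_ext_basis fun l => ?_
      cases l with
      | nil => simp [basisWord_nil]
      | cons b l =>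
        have h := basisWord_append [b] l
        rw [List.singleton_append] at h
        simp [h, g, counit, wordsHom_letter]
    exact LinearMap.congr_fun this t
  rw [hprod, map_smul, hχ, moment_gaussian, smul_eq_mul]

/-- Stability of the Gaussian law: this pair is the test case to which the additivity of an
arbitrary cumulant polynomial is applied. -/
theorem exists_bifree_gaussian {r : ℂ} (hr : r ^ 2 = 2) :
    ∃ (A : Type max u v) (_ : Ring A) (_ : Algebra ℂ A) (φ : A →ₗ[ℂ] ℂ) (z' z'' : I ⊕ J → A),
      φ 1 = 1 ∧ IsBifree φ ![z', z''] ∧ moment (distribution φ z') = moment (gaussian C) ∧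
      moment (distribution φ z'') = moment (gaussian C) ∧
      moment (distribution φ (z' + z'')) = fun s => r ^ s.length * moment (gaussian C) s := by
  let Y : Fin 2 → StateSpace.{max u v} := fun _ => fockSpace I J
  let T : ∀ k, I ⊕ J → Module.End ℂ (Y k).carrier := fun _ a => fockOp a a (C a)
  let z : Fin 2 → I ⊕ J → Module.End ℂ (FreeProduct Y) := fun k a => faceOp Y a k (T k a)
  have hz : ∀ k, moment (distribution (vacuumState Y) (z k)) = moment (gaussian C) := by
    intro k
    funext s
    have := vacuumState_prod Y T (s.map (Prod.mk k))
    rw [mixed_paint_const s k _ (spaceMoment_nil Y T k), List.map_map] at this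
    rw [moment_distribution, moment_gaussian]
    exact this
  refine ⟨Module.End ℂ (FreeProduct Y), inferInstance, inferInstance, vacuumState Y, z 0, z 1,
    map_one (vacuumCoeff Y), ⟨Y, T, ?_⟩, hz 0, hz 1, ?_⟩
  · rw [bifree_family_eq]
    congr 1
    funext p
    rcases p with ⟨k, a⟩
    fin_cases k <;> rfl
  · funext s
    rw [moment_distribution, ← counit_sum_fockOp C hr, ← vacuumCoeff_fockSpace,
      vacuumState_apply]
    have hsum : z 0 + z 1 = fun a => ∑ k, faceOp Y a k (T k a) := by
      funext a
      rw [Fin.sum_univ_two]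
      rfl
    rw [hsum, coe_prod_apply Y _ (fun a => ∑ k, faceTensor Y a k (T k a))]
    · rfl
    · intro a t
      simp [coe_faceOp]

end Gaussian

/-! ### Vanishing cumulants and determination by second moments -/

section Uniqueness

open MvPolynomial

variable {I : Type u} {J : Type v} (C : I ⊕ J → I ⊕ J → ℂ)

/-- The scaling factor of each monomial is `r` to its weight, which is `n` throughout. -/
theorem eval_of_isWeightedHomogeneous {σ : Type*} {d : σ → ℕ} {P : MvPolynomial σ ℂ} {n : ℕ}
    (hP : IsWeightedHomogeneous d P n) (r : ℂ) (m : σ → ℂ) :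
    eval (fun t => r ^ d t * m t) P = r ^ n * eval m P := by
  rw [eval_eq, eval_eq, Finset.mul_sum]
  refine Finset.sum_congr rfl fun e he => ?_
  have hw : Finsupp.weight d e = n := hP (mem_support_iff.1 he)
  have hn : r ^ n = ∏ t ∈ e.support, (r ^ d t) ^ e t := by
    rw [← hw, Finsupp.weight_apply, Finsupp.sum, ← Finset.prod_pow_eq_pow_sum]
    exact Finset.prod_congr rfl fun t _ => by rw [← pow_mul, smul_eq_mul, mul_comm]
  simp_rw [mul_pow, Finset.prod_mul_distrib, ← hn]
  ring

/-- All cumulants of order different from two of the distribution `gaussian C` vanish. -/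
theorem eval_moment_gaussian {s : List (I ⊕ J)} (hs : s.length ≠ 2)
    {P : MvPolynomial (List (I ⊕ J)) ℂ} (hP : IsCumulantPolynomial s P) :
    eval (moment (gaussian C)) P = 0 := by
  have hr : ((√2 : ℝ) : ℂ) ^ 2 = 2 := by
    rw [← Complex.ofReal_pow, Real.sq_sqrt (by norm_num)]
    norm_num
  obtain ⟨A, _, _, φ, z', z'', h1, hfree, h', h'', hsum⟩ := exists_bifree_gaussian C hr
  have h := hP.2.2 A φ z' z'' h1 hfree
  rw [h', h'', hsum, eval_of_isWeightedHomogeneous hP.2.1] at h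
  -- As `2 = (√2)^2` and `√2 ≠ 1`, equality would force length two.
  have hne : ((√2 : ℝ) : ℂ) ^ s.length ≠ 2 := by
    intro h
    rw [← hr, ← Complex.ofReal_pow, ← Complex.ofReal_pow, Complex.ofReal_inj] at h
    refine hs (pow_right_injective₀ (by positivity) ?_ h)
    intro h
    have h2 := Real.sq_sqrt (show (0 : ℝ) ≤ 2 by norm_num)
    rw [h] at h2
    norm_num at h2
  have h0 : (((√2 : ℝ) : ℂ) ^ s.length - 2) * eval (moment (gaussian C)) P = 0 := by
    rw [sub_mul, ← h]
    ring
  exact (mul_eq_zero.1 h0).resolve_left (sub_ne_zero.2 hne)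

theorem isCentralLimit_gaussian : IsCentralLimit (gaussian C) := by
  refine ⟨gaussian_one C, fun s hs => ?_⟩
  have : NeZero s.length := ⟨by omega⟩
  have hP := isCumulantPolynomial_cumulantPoly s
  exact ⟨_, hP, eval_moment_gaussian C (by omega) hP⟩

theorem functional_ext {S : Type*} {γ γ' : FreeAlgebra ℂ S →ₗ[ℂ] ℂ}
    (h : ∀ s, moment γ s = moment γ' s) : γ = γ' := by
  let e := (FreeAlgebra.equivMonoidAlgebraFreeMonoid (R := ℂ) (X := S)).symm.toLinearEquiv
  have hb : ∀ l : List S, e (basisWord l) = (l.map (FreeAlgebra.ι ℂ)).prod := by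
    intro l
    change MonoidAlgebra.lift ℂ (FreeAlgebra ℂ S) (FreeMonoid S)
      (FreeMonoid.lift (FreeAlgebra.ι ℂ)) (basisWord l) = _
    rw [basisWord, MonoidAlgebra.lift_of, FreeMonoid.lift_apply]
    rfl
  have : γ ∘ₗ e.toLinearMap = γ' ∘ₗ e.toLinearMap := by
    refine words_ext_basis fun l => ?_
    simpa [hb, moment] using h l
  refine LinearMap.ext fun t => ?_
  simpa using LinearMap.congr_fun this (e.symm t)

/-- Strong induction on the length. The vanishing cumulant expresses a moment through those of
proper subwords, in the same way for both functionals. -/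
theorem eq_gaussian {γ : FreeAlgebra ℂ (I ⊕ J) →ₗ[ℂ] ℂ} (hγ : IsCentralLimit γ)
    (hC : ∀ k l, γ (FreeAlgebra.ι ℂ k * FreeAlgebra.ι ℂ l) = C k l) : γ = gaussian C := by
  refine functional_ext fun s => ?_
  induction h : s.length using Nat.strong_induction_on generalizing s with
  | _ n ih =>
    subst h
    by_cases h2 : s.length = 2
    · obtain ⟨k, l, rfl⟩ := List.length_eq_two.1 h2
      simpa [moment, hC] using (gaussian_ι_mul_ι C k l).symm
    by_cases h0 : s.length = 0
    · obtain rfl := List.length_eq_zero_iff.1 h0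
      simp [moment, hγ.1, gaussian_one]
    obtain ⟨P, hP, hP0⟩ := hγ.2 s (by omega)
    have hP1 := eval_moment_gaussian C h2 hP
    -- The polynomial `P` comes from the hypothesis on `γ`, and the Gaussian cumulant vanishes for
    -- any such `P`. Its part `Q` involves only words that are shorter than `s`.
    obtain ⟨⟨Q, rfl, hQ⟩, -, -⟩ := hP
    have hQe : eval (moment γ) Q = eval (moment (gaussian C)) Q := by
      refine eval₂Hom_congr' rfl (fun t ht _ => ?_) rfl
      obtain ⟨_, hts, hne⟩ := hQ t ht
      exact ih t.length (lt_of_le_of_ne hts.length_le fun h => hne (hts.eq_of_length h)) t rfl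
    rw [map_add, eval_X] at hP0 hP1
    rw [hQe, ← hP1] at hP0
    exact add_right_cancel hP0

end Uniqueness

/-! ### The Hilbert space full Fock space -/

section FockSpace

variable {H : Type u} [NormedAddCommGroup H] [InnerProductSpace ℂ H]

theorem inner_consLin_consLin (g h : H) (n : ℕ) (s t : (tensorPow H n).carrier) :
    inner ℂ (consLin g n s) (consLin h n t) = inner ℂ g h * inner ℂ s t :=
  TensorProduct.inner_tmul (𝕜 := ℂ) g h s t

/-- The form with two different vectors, which yields the scalar in `r*(g) r(h)`. -/
theorem inner_snocLin_snocLin (g h : H) (n : ℕ) (s t : (tensorPow H n).carrier) :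
    inner ℂ (snocLin g n s) (snocLin h n t) = inner ℂ g h * inner ℂ s t := by
  induction n with
  | zero => exact inner_consLin_consLin g h 0 s t
  | succ n ih =>
    change inner ℂ (LinearMap.lTensor H (snocLin g n) s) (LinearMap.lTensor H (snocLin h n) t) = _
    change H ⊗[ℂ] (tensorPow H n).carrier at s t
    change _ = inner ℂ g h * inner ℂ (E := H ⊗[ℂ] (tensorPow H n).carrier) s t
    induction s using TensorProduct.induction_on with
    | zero => simp
    | add a b ha hb => rw [map_add, inner_add_left, inner_add_left, ha, hb, mul_add]
    | tmul a b =>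
      induction t using TensorProduct.induction_on with
      | zero => simp
      | add c d hc hd => rw [map_add, inner_add_right, inner_add_right, hc, hd, mul_add]
      | tmul c d =>
        rw [LinearMap.lTensor_tmul, LinearMap.lTensor_tmul]
        refine (TensorProduct.inner_tmul (𝕜 := ℂ) a c _ _).trans ?_
        rw [ih, TensorProduct.inner_tmul]
        ring

theorem consPow_coe (h : H) (n : ℕ) (t : (tensorPow H n).carrier) :
    consPow h n (t : HilbertPow H n) = (consLin h n t : HilbertPow H (n + 1)) := by
  rw [consPow, ContinuousLinearMap.completion_apply_coe]
  rfl

theorem snocPow_coe (h : H) (n : ℕ) (t : (tensorPow H n).carrier) :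
    snocPow h n (t : HilbertPow H n) = (snocLin h n t : HilbertPow H (n + 1)) := by
  rw [snocPow, ContinuousLinearMap.completion_apply_coe]
  rfl

theorem inner_consPow_consPow (g h : H) (n : ℕ) (s t : HilbertPow H n) :
    inner ℂ (consPow g n s) (consPow h n t) = inner ℂ g h * inner ℂ s t := by
  induction s, t using UniformSpace.Completion.induction_on₂ with
  | hp => exact isClosed_eq (by fun_prop) (by fun_prop)
  | ih s t =>
    rw [consPow_coe, consPow_coe, UniformSpace.Completion.inner_coe,
      UniformSpace.Completion.inner_coe, inner_consLin_consLin]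

theorem inner_snocPow_snocPow (g h : H) (n : ℕ) (s t : HilbertPow H n) :
    inner ℂ (snocPow g n s) (snocPow h n t) = inner ℂ g h * inner ℂ s t := by
  induction s, t using UniformSpace.Completion.induction_on₂ with
  | hp => exact isClosed_eq (by fun_prop) (by fun_prop)
  | ih s t =>
    rw [snocPow_coe, snocPow_coe, UniformSpace.Completion.inner_coe,
      UniformSpace.Completion.inner_coe, inner_snocLin_snocLin]

/-- On algebraic tensors this holds by definition: appending at the end acts on the inner factor,
beyond the leg added in front. Density does the rest. -/
theorem consPow_snocPow (g h : H) (n : ℕ) (t : HilbertPow H n) :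
    consPow g (n + 1) (snocPow h n t) = snocPow h (n + 1) (consPow g n t) := by
  induction t using UniformSpace.Completion.induction_on with
  | hp => exact isClosed_eq (by fun_prop) (by fun_prop)
  | ih t =>
    rw [snocPow_coe, consPow_coe, consPow_coe, snocPow_coe]
    rfl

theorem shift_apply_zero (S : ∀ n, HilbertPow H n →L[ℂ] HilbertPow H (n + 1)) (C : ℝ)
    (hC : 0 ≤ C) (hS : ∀ n t, ‖S n t‖ = C * ‖t‖) (f : Fock H) : shift S C hC hS f 0 = 0 := rfl

theorem shift_apply_succ (S : ∀ n, HilbertPow H n →L[ℂ] HilbertPow H (n + 1)) (C : ℝ)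
    (hC : 0 ≤ C) (hS : ∀ n t, ‖S n t‖ = C * ‖t‖) (f : Fock H) (n : ℕ) :
    shift S C hC hS f (n + 1) = S n (f n) := rfl

/-- The zeroth component of a shifted sequence vanishes, so the series of inner products is the old
one with its index moved by one. -/
theorem inner_shift_shift {S S' : ∀ n, HilbertPow H n →L[ℂ] HilbertPow H (n + 1)} {C C' : ℝ}
    (hC : 0 ≤ C) (hS : ∀ n t, ‖S n t‖ = C * ‖t‖) (hC' : 0 ≤ C') (hS' : ∀ n t, ‖S' n t‖ = C' * ‖t‖)
    {c : ℂ} (h : ∀ n s t, inner ℂ (S n s) (S' n t) = c * inner ℂ s t) (f g : Fock H) :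
    inner ℂ (shift S C hC hS f) (shift S' C' hC' hS' g) = c * inner ℂ f g := by
  have h1 := lp.hasSum_inner (𝕜 := ℂ) (shift S C hC hS f) (shift S' C' hC' hS' g)
  have h2 := (lp.hasSum_inner (𝕜 := ℂ) f g).mul_left c
  rw [← hasSum_nat_add_iff' 1] at h1
  simp only [Finset.sum_range_one, shift_apply_zero, inner_zero_left, sub_zero, shift_apply_succ,
    h] at h1
  exact h1.unique h2

theorem inner_fockVacuum_shift (S : ∀ n, HilbertPow H n →L[ℂ] HilbertPow H (n + 1)) (C : ℝ)
    (hC : 0 ≤ C) (hS : ∀ n t, ‖S n t‖ = C * ‖t‖) (f : Fock H) :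
    inner ℂ (fockVacuum H) (shift S C hC hS f) = 0 := by
  rw [fockVacuum, lp.inner_single_left, shift_apply_zero, inner_zero_right]

theorem inner_fockVacuum_self : inner ℂ (fockVacuum H) (fockVacuum H) = 1 := by
  rw [fockVacuum, lp.inner_single_left, lp.single_apply_self, UniformSpace.Completion.inner_coe]
  change inner ℂ (EuclideanSpace.single PUnit.unit (1 : ℂ) : EuclideanSpace ℂ PUnit)
    (EuclideanSpace.single PUnit.unit (1 : ℂ)) = 1
  simp

theorem leftCreation_rightCreation (g h : H) (f : Fock H) :
    leftCreation g (rightCreation h f) = rightCreation h (leftCreation g f) := by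
  refine lp.ext (funext fun n => ?_)
  match n with
  | 0 => rfl
  | 1 =>
    change consPow g 0 0 = snocPow h 0 0
    rw [map_zero, map_zero]
  | n + 2 => exact consPow_snocPow g h n (f n)

theorem rightCreation_fockVacuum (h : H) :
    rightCreation h (fockVacuum H) = leftCreation h (fockVacuum H) := by
  refine lp.ext (funext fun n => ?_)
  match n with
  | 0 => rfl
  | 1 => rfl
  | n + 2 =>
    have h0 : fockVacuum H (n + 1) = 0 := lp.single_apply_ne 2 0 _ (by simp)
    change snocPow h (n + 1) (fockVacuum H (n + 1)) = consPow h (n + 1) (fockVacuum H (n + 1))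
    rw [h0, map_zero, map_zero]

variable {I : Type v} {J : Type w}

/-- The creation operator `l(h)` or `r(h)`, according to the face of `a`. -/
def faceCreation (a : I ⊕ J) (h : H) : Fock H →L[ℂ] Fock H :=
  a.elim (fun _ => leftCreation h) (fun _ => rightCreation h)

theorem fockFamily_apply (h hstar : I ⊕ J → H) (a : I ⊕ J) :
    fockFamily h hstar a =
      faceCreation a (h a) + ContinuousLinearMap.adjoint (faceCreation a (hstar a)) := by
  cases a <;> rfl

theorem inner_faceCreation_faceCreation (a : I ⊕ J) (g h : H) (x y : Fock H) :
    inner ℂ (faceCreation a g x) (faceCreation a h y) = inner ℂ g h * inner ℂ x y := by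
  cases a
  · exact inner_shift_shift (norm_nonneg g) (norm_consPow g) (norm_nonneg h) (norm_consPow h)
      (inner_consPow_consPow g h) x y
  · exact inner_shift_shift (norm_nonneg g) (norm_snocPow g) (norm_nonneg h) (norm_snocPow h)
      (inner_snocPow_snocPow g h) x y

theorem inner_fockVacuum_faceCreation (a : I ⊕ J) (h : H) (x : Fock H) :
    inner ℂ (fockVacuum H) (faceCreation a h x) = 0 := by
  cases a
  · exact inner_fockVacuum_shift (consPow h) _ (norm_nonneg h) (norm_consPow h) x
  · exact inner_fockVacuum_shift (snocPow h) _ (norm_nonneg h) (norm_snocPow h) x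

/-- The Cuntz type relation `l*(g) l(h) = ⟨h, g⟩ 1` and its right analogue; it replaces any explicit
formula for annihilation. -/
theorem adjoint_faceCreation_faceCreation (a : I ⊕ J) (g h : H) (x : Fock H) :
    ContinuousLinearMap.adjoint (faceCreation a g) (faceCreation a h x) = inner ℂ g h • x := by
  refine ext_inner_left ℂ fun y => ?_
  rw [ContinuousLinearMap.adjoint_inner_right, inner_faceCreation_faceCreation, inner_smul_right]

theorem adjoint_faceCreation_fockVacuum (a : I ⊕ J) (g : H) :
    ContinuousLinearMap.adjoint (faceCreation a g) (fockVacuum H) = 0 := by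
  refine ext_inner_right ℂ fun y => ?_
  rw [ContinuousLinearMap.adjoint_inner_left, inner_fockVacuum_faceCreation, inner_zero_left]

/-- The elementary tensor of a list of vectors. -/
def fockVec (l : List H) : Fock H :=
  l.foldr (fun h x => leftCreation h x) (fockVacuum H)

/-- Elementary tensors are built by left creation. Right creation passes through to the vacuum,
where it agrees with left creation. -/
theorem faceCreation_fockVec (a : I ⊕ J) (h : H) (l : List H) :
    faceCreation a h (fockVec l) = fockVec (attach a h l) := by
  cases a with
  | inl i => rfl
  | inr j =>
    change rightCreation h (fockVec l) = fockVec (l ++ [h])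
    induction l with
    | nil => exact rightCreation_fockVacuum h
    | cons g l ih =>
      change rightCreation h (leftCreation g (fockVec l)) = leftCreation g (fockVec (l ++ [h]))
      rw [← leftCreation_rightCreation, ih]

/-- The map from the algebraic to the Hilbert space full Fock space. -/
def fockMap {S : Type*} (h : S → H) : Words S →ₗ[ℂ] Fock H :=
  Finsupp.linearCombination ℂ (fun l : FreeMonoid S => fockVec (l.toList.map h)) ∘ₗ
    (MonoidAlgebra.coeffLinearEquiv ℂ).toLinearMap

theorem fockMap_basisWord {S : Type*} (h : S → H) (l : List S) :
    fockMap h (basisWord l) = fockVec (l.map h) := by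
  have h : MonoidAlgebra.coeffLinearEquiv ℂ (basisWord l) =
      Finsupp.single (FreeMonoid.ofList l) (1 : ℂ) := rfl
  simp [fockMap, h]

/-- The weight with which `a` annihilates `b` is the scalar that the adjoint of the creation
operator of `hstar a` produces on the leg `h b`. The map need be neither injective nor isometric. -/
theorem fockMap_fockOp (h hstar : I ⊕ J → H) (a : I ⊕ J) (t : Words (I ⊕ J)) :
    fockMap h (fockOp a a (fun b => inner ℂ (hstar a) (h b)) t) =
      fockFamily h hstar a (fockMap h t) := by
  have : fockMap h ∘ₗ fockOp a a (fun b => inner ℂ (hstar a) (h b)) =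
      (fockFamily h hstar a).toLinearMap ∘ₗ fockMap h := by
    refine words_ext_basis fun l => ?_
    rw [LinearMap.comp_apply, LinearMap.comp_apply, fockOp_basisWord, map_add, fockMap_basisWord,
      fockMap_basisWord, map_attach, ContinuousLinearMap.coe_coe, fockFamily_apply,
      add_apply, faceCreation_fockVec]
    congr 1
    rcases nil_or_attach a l with rfl | ⟨b, t, rfl⟩
    · rw [detach_nil]
      exact (map_zero _).trans (adjoint_faceCreation_fockVacuum a _).symm
    · rw [detach_attach, map_attach, ← faceCreation_fockVec, adjoint_faceCreation_faceCreation,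
        map_smul, fockMap_basisWord]
  exact LinearMap.congr_fun this t

theorem inner_fockVacuum_fockMap {S : Type*} (h : S → H) (t : Words S) :
    inner ℂ (fockVacuum H) (fockMap h t) = counit S t := by
  have : (innerₛₗ ℂ (fockVacuum H)) ∘ₗ fockMap h = (counit S).toLinearMap := by
    refine words_ext_basis fun l => ?_
    rw [LinearMap.comp_apply, fockMap_basisWord]
    cases l with
    | nil =>
      rw [basisWord_nil]
      exact inner_fockVacuum_self.trans (map_one (counit S)).symm
    | cons b l =>
      -- The index `Sum.inl ()` merely selects the left face.
      have h2 := counit_letter_faceMul (Sum.inl () : Unit ⊕ Unit) b (basisWord l)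
      rw [← basisWord_attach] at h2
      exact (inner_fockVacuum_faceCreation (Sum.inl () : Unit ⊕ Unit) (h b)
        (fockVec (l.map h))).trans h2.symm
  exact LinearMap.congr_fun this t

/-- The distribution of a two-faced family of creation plus annihilation operators. -/
theorem distribution_fockFamily (h hstar : I ⊕ J → H) :
    distribution (fockState H) (fockFamily h hstar) =
      gaussian fun k l => inner ℂ (hstar k) (h l) := by
  refine functional_ext fun s => ?_
  rw [moment_distribution, moment_gaussian, ← inner_fockVacuum_fockMap h]
  have key : ∀ s : List (I ⊕ J), (s.map (fockFamily h hstar)).prod (fockVacuum H) =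
      fockMap h ((s.map fun a => fockOp a a fun b => inner ℂ (hstar a) (h b)).prod 1) := by
    intro s
    induction s with
    | nil =>
      rw [List.map_nil, List.prod_nil, List.map_nil, List.prod_nil, Module.End.one_apply,
        ← basisWord_nil, fockMap_basisWord]
      rfl
    | cons a s ih =>
      rw [List.map_cons, List.prod_cons, List.map_cons, List.prod_cons, Module.End.mul_apply,
        fockMap_fockOp, ← ih]
      rfl
  rw [← key]
  rfl

end FockSpace

end BiFree

end

/-! ### The theorem: existence and uniqueness, Fock realization, finite index sets -/

theorem theorem7p4 (I : Type u) (J : Type v) :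
    -- existence and uniqueness of the central limit distribution with given second moments
    (∀ C : I ⊕ J → I ⊕ J → ℂ,
      ∃! γ : FreeAlgebra ℂ (I ⊕ J) →ₗ[ℂ] ℂ, BiFree.IsCentralLimit γ ∧
        ∀ k l, γ (FreeAlgebra.ι ℂ k * FreeAlgebra.ι ℂ l) = C k l) ∧
    -- realization on the full Fock space
    (∀ (H : Type w) [NormedAddCommGroup H] [InnerProductSpace ℂ H] [CompleteSpace H]
      (h hstar : I ⊕ J → H),
      BiFree.IsCentralLimit
        (BiFree.distribution (BiFree.fockState H) (BiFree.fockFamily h hstar)) ∧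
      ∀ k l, BiFree.distribution (BiFree.fockState H) (BiFree.fockFamily h hstar)
        (FreeAlgebra.ι ℂ k * FreeAlgebra.ι ℂ l) = inner ℂ (hstar k) (h l)) ∧
    -- for finite index sets every central limit distribution arises in this way
    (Finite I → Finite J → ∀ γ : FreeAlgebra ℂ (I ⊕ J) →ₗ[ℂ] ℂ, BiFree.IsCentralLimit γ →
      ∃ (H : Type) (_ : NormedAddCommGroup H) (_ : InnerProductSpace ℂ H) (_ : CompleteSpace H)
        (h hstar : I ⊕ J → H),
        γ = BiFree.distribution (BiFree.fockState H) (BiFree.fockFamily h hstar)) := by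

  refine ⟨fun C => ⟨BiFree.gaussian C, ⟨BiFree.isCentralLimit_gaussian C,
    BiFree.gaussian_ι_mul_ι C⟩, fun γ hγ => BiFree.eq_gaussian C hγ.1 hγ.2⟩, ?_, ?_⟩
  · intro H _ _ _ h hstar
    rw [BiFree.distribution_fockFamily]
    exact ⟨BiFree.isCentralLimit_gaussian _, BiFree.gaussian_ι_mul_ι _⟩
  · intro _ _ γ hγ
    obtain ⟨N, ⟨e⟩⟩ := Finite.exists_equiv_fin (I ⊕ J)
    -- Here `hstar k` is the basis vector numbered by `k` and `h l` is the `l`-th column of the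
    -- covariance matrix, so their inner product is the entry `γ(Z_k Z_l)`. Finiteness gives the
    -- columns a place in a finite-dimensional space.
    refine ⟨EuclideanSpace ℂ (Fin N), inferInstance, inferInstance, inferInstance,
      fun l => WithLp.toLp 2 fun k =>
        γ (FreeAlgebra.ι ℂ (e.symm k) * FreeAlgebra.ι ℂ l),
      fun k => EuclideanSpace.single (e k) 1, ?_⟩
    rw [BiFree.distribution_fockFamily]
    refine BiFree.eq_gaussian _ hγ fun k l => ?_
    simp [EuclideanSpace.inner_single_left]
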